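/- **Setting.** All algebras are over $\mathbb{C}$. Let $l\in\mathbb{C}$ satisfy either $0<|l|<1$, or $l=e^{i\theta}$ with $0<\theta\le\pi$. Let $\mathcal{D}_l$ be the Lie algebra with basis $e_1,e_2,e_3$ and brackets $[e_3,e_1]=e_1$, $[e_3,e_2]=l\,e_2$, $[e_1,e_2]=0$. A *left-symmetric algebra on $\mathcal{D}_l$* is a complex vector space $A$ with a bilinear product whose associator $(x,y,z)=(xy)z-x(yz)$ satisfies $(x,y,z)=(y,x,z)$ for all $x,y,z$, and such that the Lie algebra $(A,\ [x,y]=xy-yx)$ is isomorphic to $\mathcal{D}_l$. Write $R_x(y)=yx$. Such an $A$ is *transitive* if every $R_x$ is nilpotent, *Novikov* if $R_xR_y=R_yR_x$ for all $x,y$, *bi-symmetric* if $(x,y,z)=(x,z,y)$ for all $x,y,z$, and *simple* if its only two-sided ideals are $0$ and $A$. The following algebras have basis $e_1,e_2,e_3$. Products $e_ie_j$ that are not listed are $0$; $\lambda\in\mathbb{C}$. - $(D_l\text{-}1)_\lambda$: $e_3e_1=e_1,\ e_3e_2=le_2,\ e_3e_3=\lambda e_3$. - $(D_l\text{-}4)_\lambda$: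 $e_2e_3=\lambda e_2,\ e_3e_1=e_1,\ e_3e_2=(\lambda+l)e_2,\ e_3e_3=\lambda e_3$. - $(D_l\text{-}5)$: $e_2e_3=-le_2,\ e_3e_1=e_1,\ e_3e_3=-le_3+e_2$. - $(D_l\text{-}8)$: $e_2e_3=e_2,\ e_3e_1=e_1,\ e_3e_2=(1+l)e_2,\ e_3e_3=e_3+e_1$. - $(D_{-1}\text{-T-}1)$: $e_2e_3=e_2,\ e_3e_1=e_1,\ e_3e_3=e_3+e_1+e_2$. - $(D_l\text{-}10)$: $e_1e_2=e_2e_1=e_3,\ e_3e_1=e_1,\ e_3e_2=le_2,\ e_3e_3=(l+1)e_3$. - $(D_l\text{-}11)_\lambda$: $e_1e_3=\lambda e_1,\ e_2e_3=\lambda e_2,\ e_3e_1=(\lambda+1)e_1,\ e_3e_2=(\lambda+l)e_2,\ e_3e_3=\lambda e_3$. - $(D_l\text{-}12)$: $e_1e_3=-e_1,\ e_2e_3=-e_2,\ e_3e_2=(l-1)e_2,\ e_3e_3=-e_3+e_1$. - $(D_l\text{-}13)$: $e_1e_3=-le_1,\ e_2e_3=-le_2,\ e_3e_1=(1-l)e_1,\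 e_3e_3=-le_3+e_2$. - $(D_l\text{-}14)$: $e_1e_3=(l-1)e_1,\ e_2e_3=(l-1)e_2+e_1,\ e_3e_1=le_1,\ e_3e_2=(2l-1)e_2+e_1,\ e_3e_3=(l-1)e_3$. - $(D_{1/2}\text{-S-}1)_\lambda$: $e_2e_2=e_1,\ e_3e_1=e_1,\ e_3e_2=\tfrac12e_2,\ e_3e_3=\lambda e_3$. - $(D_{1/2}\text{-S-}4)$: $e_1e_3=-\tfrac12e_1,\ e_2e_3=-\tfrac12e_2+e_1,\ e_3e_1=\tfrac12e_1,\ e_3e_2=e_1,\ e_3e_3=-\tfrac12e_3+e_2$. - $(D_{1/2}\text{-S-}5)_\lambda$: $e_1e_3=\lambda e_1,\ e_2e_2=e_1,\ e_2e_3=\lambda e_2,\ e_3e_1=(\lambda+1)e_1,\ e_3e_2=(\lambda+\tfrac12)e_2,\ e_3e_3=\lambda e_3$. - $(D_{1/2}\text{-S-}6)$: $e_1e_3=-e_1,\ e_2e_2=e_1,\ e_2e_3=-e_2,\ e_3e_2=-\tfrac12e_2,\ e_3e_3=-e_3+e_1$. - $(D_{1/2}\text{-S-}7)$: $e_1e_2=e_2e_1=e_3,\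 e_2e_2=e_1,\ e_3e_1=e_1,\ e_3e_2=\tfrac12e_2,\ e_3e_3=\tfrac32e_3$. **Proposition 3.14.** For every $l$ as above and every complex algebra $A$ with bilinear product: a) $A$ is an associative left-symmetric algebra on $\mathcal{D}_l$ if and only if $l=-1$ and $A\cong(D_{-1}\text{-}4)_1$. b) $A$ is a transitive left-symmetric algebra on $\mathcal{D}_l$ if and only if $A\cong(D_l\text{-}1)_0$, or $l=-1$ and $A\cong(D_{-1}\text{-}10)$, or $l=\tfrac12$ and $A\cong(D_{1/2}\text{-S-}1)_0$. c) $A$ is a left-symmetric algebra on $\mathcal{D}_l$ that is Novikov if and only if $A$ is isomorphic to $(D_l\text{-}1)_0$, to $(D_l\text{-}11)_\lambda$ for some $\lambda\ne0$, to $(D_l\text{-}12)$, or to $(D_l\text{-}13)$, or $l=\tfrac12$ and $A$ is isomorphic to $(D_{1/2}\text{-}14)$, $(D_{1/2}\text{-S-}1)_0$, $(D_{1/2}\text{-S-}4)$, $(D_{1/2}\text{-S-}5)_\lambda$ for some $\lambda\ne0$, or $(D_{1/2}\text{-S-}6)$. d) $A$ is a bi-symmetric left-symmetric algebra on $\mathcal{D}_l$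 if and only if $l=-1$ and $A$ is isomorphic to $(D_{-1}\text{-}4)_1$, $(D_{-1}\text{-}5)$, $(D_{-1}\text{-}8)$, or $(D_{-1}\text{-T-}1)$. e) $A$ is a simple left-symmetric algebra on $\mathcal{D}_l$ if and only if $A\cong(D_l\text{-}10)$, or $l=\tfrac12$ and $A\cong(D_{1/2}\text{-S-}7)$. -/

import Mathlib

/-! Left-symmetric algebras on the three-dimensional complex solvable Lie algebras `D_l`. -/

namespace LSA

/-! ### The Lie algebras `D_l` -/

/-- The underlying space `ℂ³` of the Lie algebra `D_l`, with basis `e₁, e₂, e₃` the coordinate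
vectors `0, 1, 2`. -/
def DLie (_l : ℂ) : Type := Fin 3 → ℂ

instance (l : ℂ) : AddCommGroup (DLie l) := inferInstanceAs (AddCommGroup (Fin 3 → ℂ))

instance (l : ℂ) : Module ℂ (DLie l) := inferInstanceAs (Module ℂ (Fin 3 → ℂ))

/-- The bilinear bracket of `D_l` with `[e₃, e₁] = e₁`, `[e₃, e₂] = l e₂`, `[e₁, e₂] = 0`. -/
def DLie.brk (l : ℂ) (x y : Fin 3 → ℂ) : Fin 3 → ℂ :=
  ![x 2 * y 0 - x 0 * y 2, l * (x 2 * y 1 - x 1 * y 2), 0]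

theorem DLie.brk_add_left (l : ℂ) (x y z : Fin 3 → ℂ) :
    DLie.brk l (x + y) z = DLie.brk l x z + DLie.brk l y z := by
  funext i
  fin_cases i <;> simp [DLie.brk] <;> ring

theorem DLie.brk_add_right (l : ℂ) (x y z : Fin 3 → ℂ) :
    DLie.brk l x (y + z) = DLie.brk l x y + DLie.brk l x z := by
  funext i
  fin_cases i <;> simp [DLie.brk] <;> ring

theorem DLie.brk_self (l : ℂ) (x : Fin 3 → ℂ) : DLie.brk l x x = 0 := by
  funext i
  fin_cases i <;> simp [DLie.brk, mul_comm]

theorem DLie.brk_leibniz (l : ℂ) (x y z : Fin 3 → ℂ) :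
    DLie.brk l x (DLie.brk l y z) =
      DLie.brk l (DLie.brk l x y) z + DLie.brk l y (DLie.brk l x z) := by
  funext i
  fin_cases i <;> simp [DLie.brk] <;> ring

theorem DLie.brk_smul (l t : ℂ) (x y : Fin 3 → ℂ) :
    DLie.brk l x (t • y) = t • DLie.brk l x y := by
  funext i
  fin_cases i <;> simp [DLie.brk] <;> ring

instance (l : ℂ) : LieRing (DLie l) where
  bracket x y := DLie.brk l x y
  add_lie := DLie.brk_add_left l
  lie_add := DLie.brk_add_right l
  lie_self := DLie.brk_self l
  leibniz_lie := DLie.brk_leibniz l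

instance (l : ℂ) : LieAlgebra ℂ (DLie l) where
  lie_smul := DLie.brk_smul l

/-- The parameters `l` considered: `0 < |l| < 1`, or `l = e^{iθ}` with `0 < θ ≤ π`. -/
def Param (l : ℂ) : Prop :=
  (0 < ‖l‖ ∧ ‖l‖ < 1) ∨ ∃ θ : ℝ, 0 < θ ∧ θ ≤ Real.pi ∧ l = Complex.exp (θ * Complex.I)

/-! ### Classes of (not necessarily associative) algebras -/

section Classes

variable (A : Type*) [NonUnitalNonAssocRing A] [Module ℂ A]

/-- The associator `(x, y, z) = (xy)z - x(yz)` is symmetric in `x, y`. -/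
def IsLeftSymmetric : Prop := ∀ x y z : A, associator x y z = associator y x z

/-- `A` is a left-symmetric algebra on `D_l`: it is left-symmetric, and its sub-adjacent Lie
algebra (`A` with the commutator `xy - yx`) is isomorphic to `D_l`. -/
def IsLeftSymmetricOn (l : ℂ) : Prop :=
  IsLeftSymmetric A ∧ ∃ f : A ≃ₗ[ℂ] DLie l, ∀ x y : A, f (x * y - y * x) = ⁅f x, f y⁆

/-- Associativity. -/
def IsAssoc : Prop := ∀ x y z : A, (x * y) * z = x * (y * z)

/-- Transitivity (completeness): every right multiplication `R_x : y ↦ yx` is nilpotent. -/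
def IsTransitive [IsScalarTower ℂ A A] : Prop :=
  ∀ x : A, IsNilpotent (LinearMap.mulRight ℂ x : Module.End ℂ A)

/-- The right multiplications commute (the Novikov condition on a left-symmetric algebra). -/
def IsNovikov [IsScalarTower ℂ A A] : Prop :=
  ∀ x y : A, Commute (LinearMap.mulRight ℂ x : Module.End ℂ A) (LinearMap.mulRight ℂ y)

/-- The associator is right-symmetric (bi-symmetry of a left-symmetric algebra). -/
def IsBiSymmetric : Prop := ∀ x y z : A, associator x y z = associator x z y

/-- No two-sided ideals except zero and the algebra itself. -/
def IsSimpleAlg : Prop :=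
  ∀ I : Submodule ℂ A, (∀ x : A, ∀ y ∈ I, x * y ∈ I ∧ y * x ∈ I) → I = ⊥ ∨ I = ⊤

/-- Isomorphism of algebras: a linear isomorphism that respects the products. -/
def AlgIso (B : Type*) [NonUnitalNonAssocRing B] [Module ℂ B] : Prop :=
  ∃ f : A ≃ₗ[ℂ] B, ∀ x y : A, f (x * y) = f x * f y

end Classes

/-! ### Algebras given by a characteristic matrix -/

/-- The algebra on `ℂ³` with characteristic matrix `M`: the `(i, j)` entry of `M` is the product
`eᵢ eⱼ` of the coordinate vectors. -/
def CharAlg (_M : Fin 3 → Fin 3 → Fin 3 → ℂ) : Type := Fin 3 → ℂ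

/-- The bilinear extension of `(eᵢ, eⱼ) ↦ M i j`. -/
def CharAlg.prd (M : Fin 3 → Fin 3 → Fin 3 → ℂ) (x y : Fin 3 → ℂ) : Fin 3 → ℂ :=
  ∑ i, ∑ j, (x i * y j) • M i j

instance (M : Fin 3 → Fin 3 → Fin 3 → ℂ) : AddCommGroup (CharAlg M) :=
  inferInstanceAs (AddCommGroup (Fin 3 → ℂ))

instance (M : Fin 3 → Fin 3 → Fin 3 → ℂ) : Module ℂ (CharAlg M) :=
  inferInstanceAs (Module ℂ (Fin 3 → ℂ))

theorem CharAlg.prd_add_right (M : Fin 3 → Fin 3 → Fin 3 → ℂ) (x y z : Fin 3 → ℂ) :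
    CharAlg.prd M x (y + z) = CharAlg.prd M x y + CharAlg.prd M x z := by
  simp [CharAlg.prd, mul_add, add_smul, Finset.sum_add_distrib]

theorem CharAlg.prd_add_left (M : Fin 3 → Fin 3 → Fin 3 → ℂ) (x y z : Fin 3 → ℂ) :
    CharAlg.prd M (x + y) z = CharAlg.prd M x z + CharAlg.prd M y z := by
  simp [CharAlg.prd, add_mul, add_smul, Finset.sum_add_distrib]

theorem CharAlg.prd_zero_left (M : Fin 3 → Fin 3 → Fin 3 → ℂ) (x : Fin 3 → ℂ) :
    CharAlg.prd M 0 x = 0 := by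
  simp [CharAlg.prd]

theorem CharAlg.prd_zero_right (M : Fin 3 → Fin 3 → Fin 3 → ℂ) (x : Fin 3 → ℂ) :
    CharAlg.prd M x 0 = 0 := by
  simp [CharAlg.prd]

theorem CharAlg.prd_smul_left (M : Fin 3 → Fin 3 → Fin 3 → ℂ) (t : ℂ) (x y : Fin 3 → ℂ) :
    CharAlg.prd M (t • x) y = t • CharAlg.prd M x y := by
  simp [CharAlg.prd, Finset.smul_sum, smul_smul, mul_assoc]

theorem CharAlg.prd_smul_right (M : Fin 3 → Fin 3 → Fin 3 → ℂ) (t : ℂ) (x y : Fin 3 → ℂ) :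
    CharAlg.prd M x (t • y) = t • CharAlg.prd M x y := by
  simp [CharAlg.prd, Finset.smul_sum, smul_smul, mul_left_comm]

instance (M : Fin 3 → Fin 3 → Fin 3 → ℂ) : NonUnitalNonAssocRing (CharAlg M) where
  mul x y := CharAlg.prd M x y
  left_distrib := CharAlg.prd_add_right M
  right_distrib := CharAlg.prd_add_left M
  zero_mul := CharAlg.prd_zero_left M
  mul_zero := CharAlg.prd_zero_right M

instance (M : Fin 3 → Fin 3 → Fin 3 → ℂ) : IsScalarTower ℂ (CharAlg M) (CharAlg M) :=
  ⟨CharAlg.prd_smul_left M⟩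

instance (M : Fin 3 → Fin 3 → Fin 3 → ℂ) : SMulCommClass ℂ (CharAlg M) (CharAlg M) :=
  ⟨fun t x y => (CharAlg.prd_smul_right M t x y).symm⟩

/-! ### The named algebras: row `i`, column `j` of each table is the product `eᵢ eⱼ` -/

/-- First coordinate vector. -/
def e₁ : Fin 3 → ℂ := ![1, 0, 0]

/-- Second coordinate vector. -/
def e₂ : Fin 3 → ℂ := ![0, 1, 0]

/-- Third coordinate vector. -/
def e₃ : Fin 3 → ℂ := ![0, 0, 1]

/-- `(D_l-1)_t`. -/
def D1 (l t : ℂ) : Fin 3 → Fin 3 → Fin 3 → ℂ :=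
  ![![0, 0, 0],
    ![0, 0, 0],
    ![e₁, l • e₂, t • e₃]]

/-- `(D_l-4)_t`. -/
def D4 (l t : ℂ) : Fin 3 → Fin 3 → Fin 3 → ℂ :=
  ![![0, 0, 0],
    ![0, 0, t • e₂],
    ![e₁, (t + l) • e₂, t • e₃]]

/-- `(D_l-5)`. -/
def D5 (l : ℂ) : Fin 3 → Fin 3 → Fin 3 → ℂ :=
  ![![0, 0, 0],
    ![0, 0, (-l) • e₂],
    ![e₁, 0, (-l) • e₃ + e₂]]

/-- `(D_l-8)`. -/
def D8 (l : ℂ) : Fin 3 → Fin 3 → Fin 3 → ℂ :=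
  ![![0, 0, 0],
    ![0, 0, e₂],
    ![e₁, (1 + l) • e₂, e₃ + e₁]]

/-- `(D_{-1}-T-1)`. -/
def DT1 : Fin 3 → Fin 3 → Fin 3 → ℂ :=
  ![![0, 0, 0],
    ![0, 0, e₂],
    ![e₁, 0, e₃ + e₁ + e₂]]

/-- `(D_l-10)`. -/
def D10 (l : ℂ) : Fin 3 → Fin 3 → Fin 3 → ℂ :=
  ![![0, e₃, 0],
    ![e₃, 0, 0],
    ![e₁, l • e₂, (l + 1) • e₃]]

/-- `(D_l-11)_t`. -/
def D11 (l t : ℂ) : Fin 3 → Fin 3 → Fin 3 → ℂ :=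
  ![![0, 0, t • e₁],
    ![0, 0, t • e₂],
    ![(t + 1) • e₁, (t + l) • e₂, t • e₃]]

/-- `(D_l-12)`. -/
def D12 (l : ℂ) : Fin 3 → Fin 3 → Fin 3 → ℂ :=
  ![![0, 0, -e₁],
    ![0, 0, -e₂],
    ![0, (l - 1) • e₂, -e₃ + e₁]]

/-- `(D_l-13)`. -/
def D13 (l : ℂ) : Fin 3 → Fin 3 → Fin 3 → ℂ :=
  ![![0, 0, (-l) • e₁],
    ![0, 0, (-l) • e₂],
    ![(1 - l) • e₁, 0, (-l) • e₃ + e₂]]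

/-- `(D_l-14)`. -/
def D14 (l : ℂ) : Fin 3 → Fin 3 → Fin 3 → ℂ :=
  ![![0, 0, (l - 1) • e₁],
    ![0, 0, (l - 1) • e₂ + e₁],
    ![l • e₁, (2 * l - 1) • e₂ + e₁, (l - 1) • e₃]]

/-- `(D_{1/2}-S-1)_t`. -/
noncomputable def DS1 (t : ℂ) : Fin 3 → Fin 3 → Fin 3 → ℂ :=
  ![![0, 0, 0],
    ![0, e₁, 0],
    ![e₁, (1 / 2 : ℂ) • e₂, t • e₃]]

/-- `(D_{1/2}-S-4)`. -/
noncomputable def DS4 : Fin 3 → Fin 3 → Fin 3 → ℂ :=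
  ![![0, 0, (-1 / 2 : ℂ) • e₁],
    ![0, 0, (-1 / 2 : ℂ) • e₂ + e₁],
    ![(1 / 2 : ℂ) • e₁, e₁, (-1 / 2 : ℂ) • e₃ + e₂]]

/-- `(D_{1/2}-S-5)_t`. -/
noncomputable def DS5 (t : ℂ) : Fin 3 → Fin 3 → Fin 3 → ℂ :=
  ![![0, 0, t • e₁],
    ![0, e₁, t • e₂],
    ![(t + 1) • e₁, (t + 1 / 2) • e₂, t • e₃]]

/-- `(D_{1/2}-S-6)`. -/
noncomputable def DS6 : Fin 3 → Fin 3 → Fin 3 → ℂ :=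
  ![![0, 0, -e₁],
    ![0, e₁, -e₂],
    ![0, (-1 / 2 : ℂ) • e₂, -e₃ + e₁]]

/-- `(D_{1/2}-S-7)`. -/
noncomputable def DS7 : Fin 3 → Fin 3 → Fin 3 → ℂ :=
  ![![0, e₃, 0],
    ![e₃, e₁, 0],
    ![e₁, (1 / 2 : ℂ) • e₂, (3 / 2 : ℂ) • e₃]]

end LSA

namespace LSA

/-! ### Isomorphism invariance -/

section Iso

variable {A B C : Type*} [NonUnitalNonAssocRing A] [Module ℂ A] [NonUnitalNonAssocRing B]
  [Module ℂ B] [NonUnitalNonAssocRing C] [Module ℂ C]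

/-! Left-symmetry says exactly that the left multiplications represent the Lie algebra `D_l`, which
is solvable. As in Lie's theorem they have a common eigenvector `v`, and `e₁`, `e₂` act on it by
zero because they are eigenvectors of `ad e₃` with nonzero eigenvalues `1` and `l`
(`IsTableOn.exists_eigenvector`). The automorphisms of `D_l` that scale `e₁` and `e₂` and add a
combination of them to `e₃` bring `v`, up to a scalar, to one of `e₃`, `e₁ + e₂`, `e₁`, `e₂`. In
each position the left-symmetry equations in the structure constants leave only a few parameters,
which gives six normal forms, `typeA` to `typeF` (`IsLeftSymmetricOn.hasNormalForm`). This uses `l ≠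
0, 1, 2`, which the allowed range of `l` guarantees. Each of the five properties is invariant under
isomorphism, so it can be imposed on a normal form. A few well-chosen basis products then kill most
parameters, and a further change of basis reaches a named algebra. Conversely, every named algebra
is itself a normal form: left-symmetry and the polynomial identities are checked on basis vectors,
transitivity from the vanishing of the cube of each right multiplication, and simplicity from the
distinct eigenvalues of left multiplication by `e₃`. -/

theorem AlgIso.symm (h : AlgIso A B) : AlgIso B A := by
  obtain ⟨f, hf⟩ := h
  refine ⟨f.symm, fun x y => f.injective ?_⟩
  simp [hf]

theorem AlgIso.trans (h : AlgIso A B) (h' : AlgIso B C) : AlgIso A C := by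
  obtain ⟨f, hf⟩ := h
  obtain ⟨g, hg⟩ := h'
  exact ⟨f.trans g, fun x y => by simp [hf, hg]⟩

theorem map_associator_of_mul {f : A ≃ₗ[ℂ] B} (hf : ∀ x y : A, f (x * y) = f x * f y) (x y z : A) :
    f (associator x y z) = associator (f x) (f y) (f z) := by
  simp [associator, hf]

theorem IsLeftSymmetric.of_algIso (h : AlgIso A B) (hA : IsLeftSymmetric A) :
    IsLeftSymmetric B := by
  obtain ⟨f, hf⟩ := h
  intro x y z
  obtain ⟨x, rfl⟩ := f.surjective x
  obtain ⟨y, rfl⟩ := f.surjective y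
  obtain ⟨z, rfl⟩ := f.surjective z
  rw [← map_associator_of_mul hf, ← map_associator_of_mul hf, hA]

theorem IsLeftSymmetricOn.of_algIso {l : ℂ} (h : AlgIso A B) (hA : IsLeftSymmetricOn A l) :
    IsLeftSymmetricOn B l := by
  refine ⟨hA.1.of_algIso h, ?_⟩
  obtain ⟨f, hf⟩ := h.symm
  obtain ⟨g, hg⟩ := hA.2
  exact ⟨f.trans g, fun x y => by
    simp only [LinearEquiv.trans_apply, map_sub, hf, ← hg]⟩

theorem IsAssoc.of_algIso (h : AlgIso A B) (hA : IsAssoc A) : IsAssoc B := by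
  obtain ⟨f, hf⟩ := h
  intro x y z
  obtain ⟨x, rfl⟩ := f.surjective x
  obtain ⟨y, rfl⟩ := f.surjective y
  obtain ⟨z, rfl⟩ := f.surjective z
  simp only [← hf, hA x y z]

theorem IsBiSymmetric.of_algIso (h : AlgIso A B) (hA : IsBiSymmetric A) : IsBiSymmetric B := by
  obtain ⟨f, hf⟩ := h
  intro x y z
  obtain ⟨x, rfl⟩ := f.surjective x
  obtain ⟨y, rfl⟩ := f.surjective y
  obtain ⟨z, rfl⟩ := f.surjective z
  rw [← map_associator_of_mul hf, ← map_associator_of_mul hf, hA]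

theorem IsSimpleAlg.of_algIso (h : AlgIso A B) (hA : IsSimpleAlg A) : IsSimpleAlg B := by
  obtain ⟨f, hf⟩ := h
  intro I hI
  have := hA (I.comap f.toLinearMap) (fun x y hy => by
    have := hI (f x) (f y) hy
    simpa [hf] using this)
  rcases this with h | h
  · left
    rw [eq_bot_iff]
    intro y hy
    obtain ⟨y, rfl⟩ := f.surjective y
    have hy' : y ∈ I.comap f.toLinearMap := hy
    rw [h, Submodule.mem_bot] at hy'
    simp [hy']
  · right
    rw [eq_top_iff]
    intro y _
    obtain ⟨y, rfl⟩ := f.surjective y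
    have hy' : y ∈ I.comap f.toLinearMap := by rw [h]; trivial
    exact hy'

variable [IsScalarTower ℂ A A] [IsScalarTower ℂ B B]

theorem isNovikov_iff : IsNovikov A ↔ ∀ x y z : A, (z * x) * y = (z * y) * x := by
  constructor
  · intro h x y z
    have := LinearMap.congr_fun (h y x) z
    simpa using this
  · intro h x y
    ext z
    simpa using h y x z

theorem IsNovikov.of_algIso (h : AlgIso A B) (hA : IsNovikov A) : IsNovikov B := by
  obtain ⟨f, hf⟩ := h
  rw [isNovikov_iff] at hA ⊢
  intro x y z
  obtain ⟨x, rfl⟩ := f.surjective x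
  obtain ⟨y, rfl⟩ := f.surjective y
  obtain ⟨z, rfl⟩ := f.surjective z
  simp only [← hf, hA x y z]

theorem IsTransitive.of_algIso (h : AlgIso A B) (hA : IsTransitive A) : IsTransitive B := by
  obtain ⟨f, hf⟩ := h
  intro x
  obtain ⟨x, rfl⟩ := f.surjective x
  obtain ⟨n, hn⟩ := hA x
  refine ⟨n, ?_⟩
  have key : ∀ (n : ℕ) (y : A), ((LinearMap.mulRight ℂ (f x) : Module.End ℂ B) ^ n) (f y) =
      f (((LinearMap.mulRight ℂ x : Module.End ℂ A) ^ n) y) := by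
    intro n
    induction n with
    | zero => simp
    | succ n ih => intro y; simp [pow_succ, ← hf, ih]
  ext y
  obtain ⟨y, rfl⟩ := f.surjective y
  simp [key, hn]

end Iso

/-! ### Structure constants -/

namespace CharAlg

variable {M M' : Fin 3 → Fin 3 → Fin 3 → ℂ}

theorem prd_apply (x y : Fin 3 → ℂ) (k : Fin 3) :
    prd M x y k = ∑ i, ∑ j, x i * y j * M i j k := by
  simp [prd, Finset.sum_apply]

theorem prd_sum (p q : Fin 3 → Fin 3 → ℂ) (x y : Fin 3 → ℂ) :
    prd M (∑ i, x i • p i) (∑ j, y j • q j) = ∑ i, ∑ j, (x i * y j) • prd M (p i) (q j) := by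
  simp only [Fin.sum_univ_three, prd_add_left, prd_add_right, prd_smul_left, prd_smul_right,
    smul_add, smul_smul]
  module

theorem prd_single_right (x : Fin 3 → ℂ) (j k : Fin 3) :
    prd M x (Pi.single j 1) k = ∑ n, x n * M n j k := by
  fin_cases j <;> simp [prd_apply, Pi.single_apply]

theorem prd_single_left (y : Fin 3 → ℂ) (i k : Fin 3) :
    prd M (Pi.single i 1) y k = ∑ n, y n * M i n k := by
  fin_cases i <;> simp [prd_apply, Pi.single_apply]

theorem prd_single (i j : Fin 3) : prd M (Pi.single i 1) (Pi.single j 1) = M i j := by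
  funext k
  rw [prd_single_right]
  simp [Pi.single_apply]

/-- The coordinates of an element. -/
def co (M : Fin 3 → Fin 3 → Fin 3 → ℂ) : CharAlg M ≃ₗ[ℂ] (Fin 3 → ℂ) :=
  LinearEquiv.refl ℂ (Fin 3 → ℂ)

theorem co_mul (x y : CharAlg M) : co M (x * y) = prd M (co M x) (co M y) := rfl

theorem co_symm_mul (x y : Fin 3 → ℂ) :
    (co M).symm x * (co M).symm y = (co M).symm (prd M x y) := rfl

/-- The basis vectors as elements of the algebra. -/
def bas (M : Fin 3 → Fin 3 → Fin 3 → ℂ) (i : Fin 3) : CharAlg M := (co M).symm (Pi.single i 1)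

@[simp]
theorem co_bas (i : Fin 3) : co M (bas M i) = Pi.single i 1 := rfl

theorem co_mul_bas (x : CharAlg M) (j k : Fin 3) :
    co M (x * bas M j) k = ∑ n, co M x n * M n j k := by
  rw [co_mul, co_bas, prd_single_right]

theorem co_bas_mul (y : CharAlg M) (i k : Fin 3) :
    co M (bas M i * y) k = ∑ n, co M y n * M i n k := by
  rw [co_mul, co_bas, prd_single_left]

theorem co_bas_mul_bas (i j : Fin 3) : co M (bas M i * bas M j) = M i j := by
  rw [co_mul, co_bas, co_bas, prd_single]

theorem algIso_of_linearEquiv {A : Type*} [NonUnitalNonAssocRing A] [Module ℂ A]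
    [IsScalarTower ℂ A A] [SMulCommClass ℂ A A] (f : A ≃ₗ[ℂ] (Fin 3 → ℂ))
    (h : ∀ i j, f (f.symm (Pi.single i 1) * f.symm (Pi.single j 1)) = M i j) :
    AlgIso A (CharAlg M) := by
  refine ⟨f.trans (co M).symm, fun x y => ?_⟩
  have hx : ∀ x : A, x = ∑ i, f x i • f.symm (Pi.single i 1) := fun x => by
    apply f.injective
    rw [map_sum]
    simp only [map_smul, LinearEquiv.apply_symm_apply]
    exact pi_eq_sum_univ' (f x)
  simp only [LinearEquiv.trans_apply, co_symm_mul]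
  congr 1
  conv_lhs => rw [hx x, hx y]
  simp only [prd, ← h, Finset.sum_mul_sum, map_sum, smul_mul_smul_comm, map_smul]

/-- A change of basis: the rows of `p` are vectors of `CharAlg M` that multiply according to the
table `M'`. -/
theorem algIso_of_basis (p : Fin 3 → Fin 3 → ℂ) (hp : (Matrix.of p).det ≠ 0)
    (h : ∀ i j k, prd M (p i) (p j) k = ∑ n, M' i j n * p n k) :
    AlgIso (CharAlg M) (CharAlg M') := by
  have hdet : IsUnit (Matrix.of p).transpose.det := by simpa using hp
  let f : (Fin 3 → ℂ) ≃ₗ[ℂ] (Fin 3 → ℂ) := Matrix.toLin'OfInv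
    (Matrix.nonsing_inv_mul _ hdet) (Matrix.mul_nonsing_inv _ hdet)
  have hf : ∀ x : Fin 3 → ℂ, f x = ∑ i, x i • p i := fun x => by
    funext k
    simp [f, Matrix.toLin'OfInv, Matrix.mulVec, dotProduct, mul_comm]
  refine AlgIso.symm ⟨((co M').trans f).trans (co M).symm, fun x y => ?_⟩
  simp only [LinearEquiv.trans_apply, co_symm_mul, co_mul]
  congr 1
  rw [hf (co M' x), hf (co M' y), prd_sum]
  simp only [prd, map_sum, map_smul]
  refine Finset.sum_congr rfl fun i _ => Finset.sum_congr rfl fun j _ => ?_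
  congr 1
  funext k
  rw [hf]
  have := h i j k
  simp only [prd] at this
  rw [this]
  simp

/-- The coordinates of the associator of three basis vectors. -/
def assocCoord (M : Fin 3 → Fin 3 → Fin 3 → ℂ) (i j k m : Fin 3) : ℂ :=
  ∑ n, (M i j n * M n k m - M j k n * M i n m)

theorem co_associator_bas (i j k m : Fin 3) :
    co M (associator (bas M i) (bas M j) (bas M k)) m = assocCoord M i j k m := by
  rw [associator_apply, map_sub, Pi.sub_apply, co_mul_bas, co_bas_mul, co_bas_mul_bas,
    co_bas_mul_bas, assocCoord, Finset.sum_sub_distrib]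

theorem assocCoord_of_isLeftSymmetric (h : IsLeftSymmetric (CharAlg M)) (i j k m : Fin 3) :
    assocCoord M i j k m = assocCoord M j i k m := by
  rw [← co_associator_bas, ← co_associator_bas, h]

theorem assocCoord_of_isBiSymmetric (h : IsBiSymmetric (CharAlg M)) (i j k m : Fin 3) :
    assocCoord M i j k m = assocCoord M i k j m := by
  rw [← co_associator_bas, ← co_associator_bas, h]

theorem assocCoord_of_isAssoc (h : IsAssoc (CharAlg M)) (i j k m : Fin 3) :
    assocCoord M i j k m = 0 := by
  rw [← co_associator_bas, associator_apply, h, sub_self, map_zero, Pi.zero_apply]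

theorem sum_of_isNovikov (h : IsNovikov (CharAlg M)) (i j k m : Fin 3) :
    ∑ n, M k i n * M n j m = ∑ n, M k j n * M n i m := by
  rw [isNovikov_iff] at h
  have := congrArg (fun x => co M x m) (h (bas M i) (bas M j) (bas M k))
  rwa [co_mul_bas, co_mul_bas, co_bas_mul_bas, co_bas_mul_bas] at this

/-- The hypotheses say that right multiplication by `e₃` preserves the span of `e₁, e₂`. On the
one-dimensional quotient it acts by the scalar `M 2 2 2`, and a nilpotent scalar is zero. -/
theorem eq_zero_of_isTransitive (h : IsTransitive (CharAlg M)) (h0 : M 0 2 2 = 0)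
    (h1 : M 1 2 2 = 0) : M 2 2 2 = 0 := by
  obtain ⟨n, hn⟩ := h (bas M 2)
  have key : ∀ (n : ℕ) (y : CharAlg M),
      co M (((LinearMap.mulRight ℂ (bas M 2) : Module.End ℂ (CharAlg M)) ^ n) y) 2 =
        M 2 2 2 ^ n * co M y 2 := by
    intro n
    induction n with
    | zero => intro y; simp
    | succ n ih =>
      intro y
      rw [pow_succ, Module.End.mul_apply, ih, LinearMap.mulRight_apply, co_mul_bas,
        Fin.sum_univ_three, h0, h1]
      ring
  have := key n (bas M 2)
  rw [hn] at this
  have h2 : M 2 2 2 ^ n = 0 := by simpa using this.symm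
  exact eq_zero_of_pow_eq_zero h2

/-- A coordinate subspace that is an ideal prevents simplicity. -/
theorem not_isSimpleAlg_of_coord (S : Set (Fin 3)) (i₀ i₁ : Fin 3) (h₀ : i₀ ∈ S) (h₁ : i₁ ∉ S)
    (h : ∀ i, i ∉ S → ∀ j, ∀ k ∈ S, M i j k = 0 ∧ M j i k = 0) : ¬ IsSimpleAlg (CharAlg M) := by
  intro hs
  let I : Submodule ℂ (CharAlg M) :=
    { carrier := {x | ∀ k ∈ S, co M x k = 0}
      add_mem' := fun {x y} hx hy k hk => by
        rw [map_add, Pi.add_apply, hx k hk, hy k hk, add_zero]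
      zero_mem' := fun k _ => by simp
      smul_mem' := fun c x hx k hk => by
        rw [map_smul, Pi.smul_apply, hx k hk, smul_zero] }
  have hI := hs I (fun x y hy => by
    constructor
    · intro k hk
      rw [co_mul, prd_apply]
      refine Finset.sum_eq_zero fun i _ => Finset.sum_eq_zero fun j _ => ?_
      by_cases hj : j ∈ S
      · rw [hy j hj]; ring
      · rw [(h j hj i k hk).2]; ring
    · intro k hk
      rw [co_mul, prd_apply]
      refine Finset.sum_eq_zero fun i _ => Finset.sum_eq_zero fun j _ => ?_
      by_cases hi : i ∈ S
      · rw [hy i hi]; ring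
      · rw [(h i hi j k hk).1]; ring)
  rcases hI with hI | hI
  · have : bas M i₁ ∈ I := fun k hk => by
      have : k ≠ i₁ := fun h => h₁ (h ▸ hk)
      simp [this]
    rw [hI, Submodule.mem_bot] at this
    have h1 : co M (bas M i₁) i₁ = 0 := by rw [this]; simp
    simp at h1
  · have : bas M i₀ ∈ I := by rw [hI]; trivial
    have := this i₀ h₀
    simp at this

end CharAlg

end LSA

/-! ### Multilinear identities reduced to basis vectors -/

namespace LSA

namespace CharAlg

variable {M : Fin 3 → Fin 3 → Fin 3 → ℂ}

theorem co_associator (x y z : CharAlg M) (m : Fin 3) :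
    co M (associator x y z) m =
      ∑ i, ∑ j, ∑ k, co M x i * co M y j * co M z k * assocCoord M i j k m := by
  rw [associator_apply, map_sub, Pi.sub_apply]
  simp only [co_mul, prd_apply, assocCoord, Fin.sum_univ_three]
  ring

/-- It suffices to check an identity, alternating in the first two indices, on three pairs. -/
theorem eq_swap_of_lt {α : Type*} {F : Fin 3 → Fin 3 → α} (h01 : F 0 1 = F 1 0)
    (h02 : F 0 2 = F 2 0) (h12 : F 1 2 = F 2 1) (i j : Fin 3) : F i j = F j i := by
  fin_cases i <;> fin_cases j <;> simp [h01, h02, h12]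

theorem isBiSymmetric_of_assocCoord
    (h : ∀ i j k m, assocCoord M i j k m = assocCoord M i k j m) : IsBiSymmetric (CharAlg M) := by
  intro x y z
  apply (co M).injective
  funext m
  rw [co_associator, co_associator]
  refine Finset.sum_congr rfl fun i _ => ?_
  rw [Finset.sum_comm]
  refine Finset.sum_congr rfl fun j _ => Finset.sum_congr rfl fun k _ => ?_
  rw [h i k j m]
  ring

theorem isAssoc_of_assocCoord (h : ∀ i j k m, assocCoord M i j k m = 0) :
    IsAssoc (CharAlg M) := by
  intro x y z
  rw [← sub_eq_zero, ← associator_apply]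
  apply (co M).injective
  funext m
  rw [co_associator]
  simp [h]

theorem isNovikov_of_sum (h : ∀ k m i j, ∑ n, M k i n * M n j m = ∑ n, M k j n * M n i m) :
    IsNovikov (CharAlg M) := by
  rw [isNovikov_iff]
  intro x y z
  apply (co M).injective
  funext m
  have key : ∀ x y z : CharAlg M, co M ((z * x) * y) m =
      ∑ i, ∑ j, ∑ k, co M x i * co M y j * co M z k * ∑ n, M k i n * M n j m := by
    intro x y z
    simp only [co_mul, prd_apply, Fin.sum_univ_three]
    ring
  rw [key, key, Finset.sum_comm]
  refine Finset.sum_congr rfl fun i _ => Finset.sum_congr rfl fun j _ =>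
    Finset.sum_congr rfl fun k _ => ?_
  rw [h k m j i]
  ring

theorem isTransitive_of_cube (h : ∀ x y : CharAlg M, ((y * x) * x) * x = 0) :
    IsTransitive (CharAlg M) := fun x => ⟨3, by
  ext y
  simp [pow_succ, h]⟩

end CharAlg

/-! ### Structure constants in a standard basis of `D_l` -/

open CharAlg

/-- The table `M` defines a left-symmetric product whose commutator is the bracket of `D_l` in the
standard basis. -/
structure IsTableOn (l : ℂ) (M : Fin 3 → Fin 3 → Fin 3 → ℂ) : Prop where
  comm01 : ∀ k, M 1 0 k = M 0 1 k
  comm20 : ∀ k, M 2 0 k = M 0 2 k + e₁ k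
  comm21 : ∀ k, M 2 1 k = M 1 2 k + l * e₂ k
  leftSymm : ∀ i j k m, assocCoord M i j k m = assocCoord M j i k m

theorem isTableOn_of_lt {l : ℂ} {M : Fin 3 → Fin 3 → Fin 3 → ℂ}
    (comm01 : ∀ k, M 1 0 k = M 0 1 k) (comm20 : ∀ k, M 2 0 k = M 0 2 k + e₁ k)
    (comm21 : ∀ k, M 2 1 k = M 1 2 k + l * e₂ k)
    (h01 : ∀ k m, assocCoord M 0 1 k m = assocCoord M 1 0 k m)
    (h02 : ∀ k m, assocCoord M 0 2 k m = assocCoord M 2 0 k m)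
    (h12 : ∀ k m, assocCoord M 1 2 k m = assocCoord M 2 1 k m) : IsTableOn l M :=
  ⟨comm01, comm20, comm21, fun i j k m =>
    eq_swap_of_lt (F := fun i j => assocCoord M i j k m) (h01 k m) (h02 k m) (h12 k m) i j⟩

theorem IsTableOn.isLeftSymmetricOn {l : ℂ} {M : Fin 3 → Fin 3 → Fin 3 → ℂ}
    (h : IsTableOn l M) : IsLeftSymmetricOn (CharAlg M) l := by
  constructor
  · intro x y z
    apply (co M).injective
    funext m
    rw [co_associator, co_associator, Finset.sum_comm]
    refine Finset.sum_congr rfl fun i _ => Finset.sum_congr rfl fun j _ =>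
      Finset.sum_congr rfl fun k _ => ?_
    rw [h.leftSymm j i k m]
    ring
  · let g : (Fin 3 → ℂ) ≃ₗ[ℂ] DLie l := LinearEquiv.refl ℂ (Fin 3 → ℂ)
    have hg : ∀ x y, ⁅g x, g y⁆ = g (DLie.brk l x y) := fun _ _ => rfl
    refine ⟨(co M).trans g, fun x y => ?_⟩
    simp only [LinearEquiv.trans_apply, hg]
    congr 1
    rw [map_sub, co_mul, co_mul]
    funext k
    rw [Pi.sub_apply, prd_apply, prd_apply]
    simp only [Fin.sum_univ_three, h.comm01, h.comm20, h.comm21]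
    fin_cases k <;> simp [DLie.brk, e₁, e₂] <;> ring

/-- The standard basis of `D_l`, pulled back along the Lie isomorphism, is a basis of `A`; its
products are the table. -/
theorem IsLeftSymmetricOn.exists_isTableOn {l : ℂ} {A : Type*} [NonUnitalNonAssocRing A]
    [Module ℂ A] [IsScalarTower ℂ A A] [SMulCommClass ℂ A A] (h : IsLeftSymmetricOn A l) :
    ∃ M, IsTableOn l M ∧ AlgIso A (CharAlg M) := by
  obtain ⟨hls, f, hf⟩ := h
  let g : (Fin 3 → ℂ) ≃ₗ[ℂ] DLie l := LinearEquiv.refl ℂ (Fin 3 → ℂ)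
  have hg : ∀ x y, ⁅g x, g y⁆ = g (DLie.brk l x y) := fun _ _ => rfl
  let M : Fin 3 → Fin 3 → Fin 3 → ℂ := fun i j => (f.trans g.symm)
    ((f.trans g.symm).symm (Pi.single i 1) * (f.trans g.symm).symm (Pi.single j 1))
  have hiso : AlgIso A (CharAlg M) := algIso_of_linearEquiv (f.trans g.symm) fun _ _ => rfl
  have hcomm : ∀ i j k, M i j k = M j i k + DLie.brk l (Pi.single i 1) (Pi.single j 1) k := by
    intro i j k
    rw [← sub_eq_iff_eq_add', ← Pi.sub_apply]
    simp only [M, ← map_sub, LinearEquiv.trans_apply, hf, LinearEquiv.symm_trans_apply,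
      LinearEquiv.apply_symm_apply, LinearEquiv.symm_symm, hg, LinearEquiv.symm_apply_apply]
  refine ⟨M, ⟨fun k => ?_, fun k => ?_, fun k => ?_, ?_⟩, hiso⟩
  · rw [hcomm 1 0 k]
    fin_cases k <;> simp [DLie.brk]
  · rw [hcomm 2 0 k]
    fin_cases k <;> simp [DLie.brk, e₁]
  · rw [hcomm 2 1 k]
    fin_cases k <;> simp [DLie.brk, e₂]
  · exact assocCoord_of_isLeftSymmetric (hls.of_algIso hiso)

/-! ### Normal forms -/

/-- `e₁, e₂` annihilate `e₃` from the left. -/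
def typeA (l μ a b c d : ℂ) : Fin 3 → Fin 3 → Fin 3 → ℂ :=
  ![![![0, 0, a], ![0, 0, c], ![0, 0, 0]],
    ![![0, 0, c], ![b, 0, d], ![0, 0, 0]],
    ![![1, 0, 0], ![0, l, 0], ![0, 0, μ]]]

/-- The span of `e₁, e₂` is an ideal with trivial product, on which `e₃` acts from the right by
the matrix with columns `(p, r)` and `(q, s)`. -/
def typeB (l p q r s τ n₁ n₂ : ℂ) : Fin 3 → Fin 3 → Fin 3 → ℂ :=
  ![![![0, 0, 0], ![0, 0, 0], ![p, r, 0]],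
    ![![0, 0, 0], ![0, 0, 0], ![q, s, 0]],
    ![![p + 1, r, 0], ![q, s + l, 0], ![n₁, n₂, τ]]]

/-- The span of `e₁, e₂` is an ideal with `e₂ e₂ = e₁`. -/
def typeC (l t y τ n : ℂ) : Fin 3 → Fin 3 → Fin 3 → ℂ :=
  ![![![0, 0, 0], ![0, 0, 0], ![t, 0, 0]],
    ![![0, 0, 0], ![1, 0, 0], ![0, y, 0]],
    ![![t + 1, 0, 0], ![0, y + l, 0], ![n, 0, τ]]]

/-- The span of `e₁, e₂` is an ideal with `e₁ e₁ = e₂`. -/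
def typeD (l t y τ n : ℂ) : Fin 3 → Fin 3 → Fin 3 → ℂ :=
  ![![![0, 1, 0], ![0, 0, 0], ![y, 0, 0]],
    ![![0, 0, 0], ![0, 0, 0], ![0, t, 0]],
    ![![y + 1, 0, 0], ![0, t + l, 0], ![0, n, τ]]]

/-- `e₂ e₂` is a multiple of `e₃`. -/
def typeE (l x d : ℂ) : Fin 3 → Fin 3 → Fin 3 → ℂ :=
  ![![![0, 0, 0], ![0, 0, 0], ![0, 0, 0]],
    ![![0, 0, 0], ![0, 0, d], ![x, 0, 0]],
    ![![1, 0, 0], ![x, l, 0], ![0, 0, 2 * l]]]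

/-- `e₁ e₁` is a multiple of `e₃`. -/
def typeF (l x d : ℂ) : Fin 3 → Fin 3 → Fin 3 → ℂ :=
  ![![![0, 0, d], ![0, 0, 0], ![0, x, 0]],
    ![![0, 0, 0], ![0, 0, 0], ![0, 0, 0]],
    ![![1, x, 0], ![0, l, 0], ![0, 0, 2]]]

theorem isTableOn_typeA {l μ a b c d : ℂ} (ha : a * (μ - 2) = 0) (hb : b * (2 * l - 1) = 0)
    (hc : c * (μ - 1 - l) = 0) (hd : d * (μ - 2 * l) = 0) (hab : a * b = 0) :
    IsTableOn l (typeA l μ a b c d) := by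
  apply isTableOn_of_lt
  · intro k; fin_cases k <;> simp [typeA]
  · intro k; fin_cases k <;> simp [typeA, e₁]
  · intro k; fin_cases k <;> simp [typeA, e₂]
  all_goals
    intro k m
    fin_cases k <;> fin_cases m <;> simp [assocCoord, Fin.sum_univ_three, typeA]
  all_goals grind

theorem isTableOn_typeB {l p q r s τ n₁ n₂ : ℂ} (hp : p * p + q * r = τ * p)
    (hq : q * (p + s) + (1 - l) * q = τ * q) (hr : r * (p + s) - (1 - l) * r = τ * r)
    (hs : s * s + q * r = τ * s) :
    IsTableOn l (typeB l p q r s τ n₁ n₂) := by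
  apply isTableOn_of_lt
  · intro k; fin_cases k <;> simp [typeB]
  · intro k; fin_cases k <;> simp [typeB, e₁]
  · intro k; fin_cases k <;> simp [typeB, e₂]
  all_goals
    intro k m
    fin_cases k <;> fin_cases m <;> simp [assocCoord, Fin.sum_univ_three, typeB]
  all_goals grind

theorem isTableOn_typeC {l t y τ n : ℂ} (ht : t * (t - τ) = 0) (hy : y * (y - τ) = 0)
    (hty : y = t + 1 - 2 * l) : IsTableOn l (typeC l t y τ n) := by
  apply isTableOn_of_lt
  · intro k; fin_cases k <;> simp [typeC]
  · intro k; fin_cases k <;> simp [typeC, e₁]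
  · intro k; fin_cases k <;> simp [typeC, e₂]
  all_goals
    intro k m
    fin_cases k <;> fin_cases m <;> simp [assocCoord, Fin.sum_univ_three, typeC]
  all_goals grind

end LSA

namespace LSA

open CharAlg

/-! ### A common eigenvector of the left multiplications -/

/-- The relation makes `S` shift eigenvalues of `T` by `c`, so the nonzero vectors among the `S ^ k
v` belong to pairwise distinct eigenvalues. In finite dimension some power of `S` kills `v`; the
last nonzero vector before that is the one sought. -/
theorem exists_pow_eigenvector {V : Type*} [AddCommGroup V] [Module ℂ V] [FiniteDimensional ℂ V]
    {T S : Module.End ℂ V} {c : ℂ} (hc : c ≠ 0) (hTS : ∀ w, T (S w) = S (T w) + c • S w)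
    {v : V} (hv : v ≠ 0) {μ : ℂ} (hμ : T v = μ • v) :
    ∃ (k : ℕ) (ν : ℂ), (S ^ k) v ≠ 0 ∧ S ((S ^ k) v) = 0 ∧ T ((S ^ k) v) = ν • (S ^ k) v := by
  have heig : ∀ k : ℕ, T ((S ^ k) v) = (μ + k * c) • (S ^ k) v := by
    intro k
    induction k with
    | zero => simp [hμ]
    | succ k ih =>
      rw [pow_succ', Module.End.mul_apply, hTS, ih, map_smul, ← add_smul]
      congr 1
      push_cast
      ring
  have hex : ∃ k, (S ^ k) v = 0 := by
    by_contra! hne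
    have hinj : Function.Injective fun k : ℕ => μ + k * c := by
      intro i j hij
      simpa [hc] using hij
    refine Set.infinite_of_injective_forall_mem hinj (s := {ν | T.HasEigenvalue ν}) (fun k => ?_)
      T.finite_hasEigenvalue
    exact Module.End.hasEigenvalue_of_hasEigenvector
      ⟨Module.End.mem_eigenspace_iff.2 (heig k), hne k⟩
  classical
  obtain ⟨hk, hmin⟩ := And.intro (Nat.find_spec hex) (fun {m} => Nat.find_min hex (m := m))
  obtain ⟨k, hk'⟩ : ∃ k, Nat.find hex = k + 1 := by
    refine Nat.exists_eq_succ_of_ne_zero fun h0 => ?_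
    rw [h0] at hk
    exact hv hk
  refine ⟨k, _, hmin (by omega), ?_, heig k⟩
  rw [hk', pow_succ'] at hk
  exact hk

/-- Lie's theorem for the left regular representation, done by hand: start from an eigenvector of
left multiplication by `e₃`, push it into the kernel of `e₁` (shift `1`), then into the kernel of
`e₂` (shift `l`, nonzero). -/
theorem IsTableOn.exists_eigenvector {l : ℂ} (hl : l ≠ 0) {M : Fin 3 → Fin 3 → Fin 3 → ℂ}
    (h : IsTableOn l M) : ∃ (v : Fin 3 → ℂ) (μ : ℂ), v ≠ 0 ∧ (∀ k, ∑ n, v n * M 0 n k = 0) ∧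
      (∀ k, ∑ n, v n * M 1 n k = 0) ∧ ∀ k, ∑ n, v n * M 2 n k = μ * v k := by
  -- Left-symmetry rewritten as a representation: the commutator of two left multiplications is left
  -- multiplication by the commutator.
  have hL : ∀ i j (w : CharAlg M), bas M i * (bas M j * w) =
      bas M j * (bas M i * w) + (bas M i * bas M j - bas M j * bas M i) * w := by
    intro i j w
    have := h.isLeftSymmetricOn.1 (bas M i) (bas M j) w
    rw [associator_apply, associator_apply] at this
    rw [sub_mul, eq_comm, ← sub_eq_zero]
    rw [← sub_eq_zero] at this
    rw [← this]
    abel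
  have h01 : bas M 0 * bas M 1 - bas M 1 * bas M 0 = 0 := by
    apply (co M).injective
    rw [map_sub, co_bas_mul_bas, co_bas_mul_bas]
    funext k
    simp [h.comm01]
  have h20 : bas M 2 * bas M 0 - bas M 0 * bas M 2 = bas M 0 := by
    apply (co M).injective
    rw [map_sub, co_bas_mul_bas, co_bas_mul_bas]
    funext k
    fin_cases k <;> simp [h.comm20, e₁]
  have h21 : bas M 2 * bas M 1 - bas M 1 * bas M 2 = l • bas M 1 := by
    apply (co M).injective
    rw [map_sub, co_bas_mul_bas, co_bas_mul_bas]
    funext k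
    fin_cases k <;> simp [h.comm21, e₂]
  have : FiniteDimensional ℂ (CharAlg M) := Module.Finite.equiv (co M).symm
  have : Nontrivial (CharAlg M) := (co M).toEquiv.nontrivial
  let T : Fin 3 → Module.End ℂ (CharAlg M) := fun i => LinearMap.mulLeft ℂ (bas M i)
  have hT : ∀ i x, T i x = bas M i * x := fun i x => rfl
  obtain ⟨μ₀, hμ₀⟩ := Module.End.exists_eigenvalue (T 2)
  obtain ⟨v₀, hv₀⟩ := hμ₀.exists_hasEigenvector
  obtain ⟨k, μ₁, hne, hS, hT2⟩ := exists_pow_eigenvector (T := T 2) (S := T 0) one_ne_zero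
    (fun w => by simp only [hT]; rw [hL 2 0, h20, one_smul]) hv₀.2 hv₀.apply_eq_smul
  set v₁ := (T 0 ^ k) v₀
  obtain ⟨k', μ, hne', hS', hT2'⟩ := exists_pow_eigenvector (T := T 2) (S := T 1) hl
    (fun w => by simp only [hT]; rw [hL 2 1, h21, smul_mul_assoc]) hne hT2
  -- Left multiplications by `e₁` and `e₂` commute, so applying `e₂` does not leave the kernel of
  -- `e₁`.
  have hker : ∀ k' : ℕ, T 0 ((T 1 ^ k') v₁) = 0 := by
    intro k'
    induction k' with
    | zero => simpa using hS
    | succ n ih =>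
      rw [pow_succ', Module.End.mul_apply, hT, hT, hL 0 1, h01, zero_mul, add_zero, ← hT 0, ih,
        mul_zero]
  refine ⟨co M ((T 1 ^ k') v₁), μ, by simpa using hne', fun k => ?_, fun k => ?_, fun k => ?_⟩
  · rw [← co_bas_mul, ← hT, hker, map_zero, Pi.zero_apply]
  · rw [← co_bas_mul, ← hT, hS', map_zero, Pi.zero_apply]
  · rw [← co_bas_mul, ← hT, hT2', map_smul, Pi.smul_apply, smul_eq_mul]

/-! ### Automorphisms of `D_l` -/

/-- The basis `u e₁, w e₂, e₃ + a e₁ + b e₂`. -/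
def adaptedBasis (u w a b : ℂ) : Fin 3 → Fin 3 → ℂ := ![![u, 0, 0], ![0, w, 0], ![a, b, 1]]

theorem det_adaptedBasis (u w a b : ℂ) : (Matrix.of (adaptedBasis u w a b)).det = u * w := by
  simp [adaptedBasis, Matrix.det_fin_three]

/-- The structure constants with respect to `adaptedBasis u w a b`. -/
noncomputable def adaptedTable (M : Fin 3 → Fin 3 → Fin 3 → ℂ) (u w a b : ℂ) :
    Fin 3 → Fin 3 → Fin 3 → ℂ := fun i j =>
  let x := prd M (adaptedBasis u w a b i) (adaptedBasis u w a b j)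
  ![(x 0 - a * x 2) / u, (x 1 - b * x 2) / w, x 2]

theorem algIso_adaptedTable (M : Fin 3 → Fin 3 → Fin 3 → ℂ) {u w : ℂ} (hu : u ≠ 0) (hw : w ≠ 0)
    (a b : ℂ) : AlgIso (CharAlg M) (CharAlg (adaptedTable M u w a b)) := by
  refine algIso_of_basis (adaptedBasis u w a b)
    (by rw [det_adaptedBasis]; exact mul_ne_zero hu hw) fun i j k => ?_
  simp only [adaptedTable]
  generalize prd M (adaptedBasis u w a b i) (adaptedBasis u w a b j) = x
  fin_cases k <;> simp [Fin.sum_univ_three, adaptedBasis] <;> field_simp <;> ring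

/-- Since `e₁` and `e₂` commute, an adapted basis has the same brackets as the standard one: it
comes from an automorphism of `D_l`. -/
theorem IsTableOn.adaptedTable {l : ℂ} {M : Fin 3 → Fin 3 → Fin 3 → ℂ} (h : IsTableOn l M)
    {u w : ℂ} (hu : u ≠ 0) (hw : w ≠ 0) (a b : ℂ) : IsTableOn l (adaptedTable M u w a b) := by
  refine ⟨fun k => ?_, fun k => ?_, fun k => ?_, assocCoord_of_isLeftSymmetric
    (h.isLeftSymmetricOn.1.of_algIso (algIso_adaptedTable M hu hw a b))⟩
  all_goals
    simp only [LSA.adaptedTable, prd_apply, Fin.sum_univ_three, h.comm01, h.comm20, h.comm21]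
    fin_cases k <;> simp [adaptedBasis, e₁, e₂] <;> field_simp <;> first | ring1 | simp

end LSA

namespace LSA

open CharAlg

/-! ### Reduction to normal forms -/

/-- `A` is isomorphic to an algebra in one of the normal forms. -/
def HasNormalForm (l : ℂ) (A : Type*) [NonUnitalNonAssocRing A] [Module ℂ A] : Prop :=
  (∃ μ a b c d, a * (μ - 2) = 0 ∧ b * (2 * l - 1) = 0 ∧ c * (μ - 1 - l) = 0 ∧
      d * (μ - 2 * l) = 0 ∧ a * b = 0 ∧ AlgIso A (CharAlg (typeA l μ a b c d))) ∨
    (∃ p q r s τ n₁ n₂, p * p + q * r = τ * p ∧ q * (p + s) + (1 - l) * q = τ * q ∧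
      r * (p + s) - (1 - l) * r = τ * r ∧ s * s + q * r = τ * s ∧
      AlgIso A (CharAlg (typeB l p q r s τ n₁ n₂))) ∨
    (∃ t y τ n, t * (t - τ) = 0 ∧ y * (y - τ) = 0 ∧ y = t + 1 - 2 * l ∧
      AlgIso A (CharAlg (typeC l t y τ n))) ∨
    (∃ t y τ n, t * (t - τ) = 0 ∧ y * (y - τ) = 0 ∧ y = t + l - 2 ∧
      AlgIso A (CharAlg (typeD l t y τ n))) ∨
    (∃ x d, d ≠ 0 ∧ AlgIso A (CharAlg (typeE l x d))) ∨
    ∃ x d, d ≠ 0 ∧ AlgIso A (CharAlg (typeF l x d))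

theorem HasNormalForm.of_algIso {l : ℂ} {A B : Type*} [NonUnitalNonAssocRing A] [Module ℂ A]
    [NonUnitalNonAssocRing B] [Module ℂ B] (h : AlgIso A B) (hB : HasNormalForm l B) :
    HasNormalForm l A := by
  rcases hB with ⟨μ, a, b, c, d, h1, h2, h3, h4, h5, h6⟩ |
    ⟨p, q, r, s, τ, n₁, n₂, h1, h2, h3, h4, h5⟩ | ⟨t, y, τ, n, h1, h2, h3, h4⟩ |
    ⟨t, y, τ, n, h1, h2, h3, h4⟩ | ⟨x, d, h1, h2⟩ | ⟨x, d, h1, h2⟩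
  · exact Or.inl ⟨μ, a, b, c, d, h1, h2, h3, h4, h5, h.trans h6⟩
  · exact Or.inr (Or.inl ⟨p, q, r, s, τ, n₁, n₂, h1, h2, h3, h4, h.trans h5⟩)
  · exact Or.inr (Or.inr (Or.inl ⟨t, y, τ, n, h1, h2, h3, h.trans h4⟩))
  · exact Or.inr (Or.inr (Or.inr (Or.inl ⟨t, y, τ, n, h1, h2, h3, h.trans h4⟩)))
  · exact Or.inr (Or.inr (Or.inr (Or.inr (Or.inl ⟨x, d, h1, h.trans h2⟩))))
  · exact Or.inr (Or.inr (Or.inr (Or.inr (Or.inr ⟨x, d, h1, h.trans h2⟩))))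

variable {l : ℂ} {M : Fin 3 → Fin 3 → Fin 3 → ℂ}

theorem AlgIso.of_eq {M M' : Fin 3 → Fin 3 → Fin 3 → ℂ} (h : M = M') :
    AlgIso (CharAlg M) (CharAlg M') := by
  subst h
  exact ⟨LinearEquiv.refl ℂ _, fun _ _ => rfl⟩

/-- As `e₁e₃ = e₂e₃ = 0`, left multiplication by `e₃` is a derivation on products of `e₁, e₂`. It is
diagonal with eigenvalues `1, l, μ`, so `e₁e₁`, `e₁e₂`, `e₂e₂` have weights `2`, `1 + l`, `2l`, and
a component survives only where weights agree. Finally `e₁(e₂e₂) = e₂(e₁e₂)` gives the condition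
that a product of two parameters vanishes. -/
theorem hasNormalForm_of_annihilated (hl0 : l ≠ 0) (hl2 : l ≠ 2)
    {x₀ x₁ x₂ y₀ y₁ y₂ z₀ z₁ z₂ μ : ℂ} (h : IsTableOn l M)
    (hM : M =
      ![![![x₀, x₁, x₂], ![y₀, y₁, y₂], ![0, 0, 0]],
        ![![y₀, y₁, y₂], ![z₀, z₁, z₂], ![0, 0, 0]],
        ![![1, 0, 0], ![0, l, 0], ![0, 0, μ]]]) :
    HasNormalForm l (CharAlg M) := by
  have hE := h.leftSymm
  have e2000 := hE 2 0 0 0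
  have e2001 := hE 2 0 0 1
  have e2002 := hE 2 0 0 2
  have e2010 := hE 2 0 1 0
  have e2011 := hE 2 0 1 1
  have e2012 := hE 2 0 1 2
  have e2110 := hE 2 1 1 0
  have e2111 := hE 2 1 1 1
  have e2112 := hE 2 1 1 2
  have e0112 := hE 0 1 1 2
  simp [assocCoord, Fin.sum_univ_three, hM] at e2000 e2001 e2002 e2010 e2011 e2012 e2110 e2111 e2112 e0112
  have hx0 : x₀ = 0 := by grind
  have hx1 : x₁ = 0 := by grind
  have hy0 : y₀ = 0 := by grind
  have hy1 : y₁ = 0 := by grind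
  have hz1 : z₁ = 0 := by grind
  subst hx0 hx1 hy0 hy1 hz1
  refine Or.inl ⟨μ, x₂, z₀, y₂, z₂, by grind, by grind, by grind, by grind, by grind, ?_⟩
  exact AlgIso.of_eq hM

/-- Here the eigenvector is `e₁ + e₂`, so `e₁e₁ = -e₁e₂ = e₂e₂`. Left-symmetry with `e₃` forces this
vector and the third coordinate of `e₁e₃` to vanish, leaving an ideal with zero product. -/
theorem hasNormalForm_of_eigenvector_add (hl1 : l ≠ 1)
    {q₀ q₁ q₂ p₀ p₁ p₂ μ n₀ n₁ τ : ℂ} (h : IsTableOn l M)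
    (hM : M =
      ![![![q₀, q₁, q₂], ![-q₀, -q₁, -q₂], ![p₀, p₁, p₂]],
        ![![-q₀, -q₁, -q₂], ![q₀, q₁, q₂], ![μ - 1 - p₀, μ - l - p₁, -p₂]],
        ![![p₀ + 1, p₁, p₂], ![μ - 1 - p₀, μ - p₁, -p₂], ![n₀, n₁, τ]]]) :
    HasNormalForm l (CharAlg M) := by
  have hE := h.leftSymm
  have e2000 := hE 2 0 0 0
  have e2001 := hE 2 0 0 1
  have e2002 := hE 2 0 0 2
  have e2010 := hE 2 0 1 0
  have e2011 := hE 2 0 1 1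
  have e2012 := hE 2 0 1 2
  have e2020 := hE 2 0 2 0
  have e2021 := hE 2 0 2 1
  have e2022 := hE 2 0 2 2
  have e2100 := hE 2 1 0 0
  have e2101 := hE 2 1 0 1
  have e2102 := hE 2 1 0 2
  have e2110 := hE 2 1 1 0
  have e2111 := hE 2 1 1 1
  have e2112 := hE 2 1 1 2
  have e2120 := hE 2 1 2 0
  have e2121 := hE 2 1 2 1
  have e2122 := hE 2 1 2 2
  simp [assocCoord, Fin.sum_univ_three, hM] at e2000 e2001 e2002 e2010 e2011 e2012 e2020 e2021 e2022 e2100 e2101 e2102 e2110 e2111 e2112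
  simp [assocCoord, Fin.sum_univ_three, hM] at e2120 e2121 e2122
  have hl1' : 1 - l ≠ 0 := sub_ne_zero.2 hl1.symm
  have h2 : q₂ = 0 := by grind
  subst h2
  have htr : p₂ = q₁ - q₀ := by grind
  subst htr
  have h3 : q₀ = q₁ := by grind
  subst h3
  have h0 : q₀ = 0 := by grind
  subst h0
  refine Or.inr (Or.inl ⟨p₀, μ - 1 - p₀, p₁, μ - l - p₁, τ, n₀, n₁, by grind, by grind, by grind,
    by grind, ?_⟩)
  refine AlgIso.of_eq ?_
  rw [hM]
  funext i j k
  fin_cases i <;> fin_cases j <;> fin_cases k <;> simp [typeB]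
  ring

/-- Here the eigenvector is `e₁`, and the form depends on `e₂e₂`: zero gives `typeB`, a nonzero
multiple of `e₁` gives `typeC`, and a nonzero third coordinate gives `typeE`. -/
theorem hasNormalForm_of_eigenvector_fst (hl0 : l ≠ 0)
    {t α β c x y z n₀ n₁ τ : ℂ} (h : IsTableOn l M)
    (hM : M =
      ![![![0, 0, 0], ![0, 0, 0], ![t, 0, 0]],
        ![![0, 0, 0], ![α, β, c], ![x, y, z]],
        ![![t + 1, 0, 0], ![x, y + l, z], ![n₀, n₁, τ]]]) :
    HasNormalForm l (CharAlg M) := by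
  have hE := h.leftSymm
  have e0110 := hE 0 1 1 0
  have e0120 := hE 0 1 2 0
  have e2000 := hE 2 0 0 0
  have e2001 := hE 2 0 0 1
  have e2002 := hE 2 0 0 2
  have e2010 := hE 2 0 1 0
  have e2011 := hE 2 0 1 1
  have e2012 := hE 2 0 1 2
  have e2020 := hE 2 0 2 0
  have e2021 := hE 2 0 2 1
  have e2022 := hE 2 0 2 2
  have e2100 := hE 2 1 0 0
  have e2101 := hE 2 1 0 1
  have e2102 := hE 2 1 0 2
  have e2110 := hE 2 1 1 0
  have e2111 := hE 2 1 1 1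
  have e2112 := hE 2 1 1 2
  have e2120 := hE 2 1 2 0
  have e2121 := hE 2 1 2 1
  have e2122 := hE 2 1 2 2
  simp [assocCoord, Fin.sum_univ_three, hM] at e0110 e0120 e2000 e2001 e2002 e2010 e2011 e2012 e2020 e2021 e2022 e2100 e2101 e2102 e2110 e2111 e2112
  simp [assocCoord, Fin.sum_univ_three, hM] at e2120 e2121 e2122
  have hz : z = -β := by grind
  subst hz
  by_cases hc : c = 0
  · subst hc
    have hβ : β = 0 := by grind
    subst hβ
    by_cases hα : α = 0
    · subst hα
      refine Or.inr (Or.inl ⟨t, x, 0, y, τ, n₀, n₁, by grind, by grind, by grind, by grind, ?_⟩)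
      refine AlgIso.of_eq ?_
      rw [hM]
      funext i j k
      fin_cases i <;> fin_cases j <;> fin_cases k <;> simp [typeB]
    · refine Or.inr (Or.inr (Or.inl ⟨t, y, τ, (n₀ - 2 * x * x / α + x * x / α) / α, by grind,
        by grind, by grind, ?_⟩))
      -- Scaling `e₁` by `α` makes `e₂e₂ = e₁`; subtracting `(x / α) e₂` from `e₃` removes the `e₁`
      -- component of `e₂e₃`.
      refine (algIso_adaptedTable M hα one_ne_zero 0 (-x / α)).trans (AlgIso.of_eq ?_)
      rw [hM]
      funext i j k
      fin_cases i <;> fin_cases j <;> fin_cases k <;>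
        simp [typeC, LSA.adaptedTable, prd_apply, Fin.sum_univ_three, adaptedBasis] <;> grind
  -- Now `e₂e₂ = c (a e₁ + b e₂ + e₃)`, and the bracketed vector becomes the new `e₃`.
  · obtain ⟨a, rfl⟩ : ∃ a, α = a * c := ⟨α / c, by field_simp⟩
    obtain ⟨b, rfl⟩ : ∃ b, β = b * c := ⟨β / c, by field_simp⟩
    have ht : t = 0 := by grind
    subst ht
    have hy : y = -(b * b * c) := by grind
    subst hy
    have hτ : τ = 2 * l + b * b * c := by grind
    subst hτ
    have hn₁ : n₁ = b * (l + b * b * c) := by grind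
    subst hn₁
    have hn₀ : n₀ = a * (2 * l - 1 - b * b * c) - 2 * b * x := by grind
    subst hn₀
    refine Or.inr (Or.inr (Or.inr (Or.inr (Or.inl ⟨b * a * c + x, c, hc, ?_⟩))))
    refine (algIso_adaptedTable M one_ne_zero one_ne_zero a b).trans (AlgIso.of_eq ?_)
    rw [hM]
    funext i j k
    fin_cases i <;> fin_cases j <;> fin_cases k <;>
      simp [typeE, LSA.adaptedTable, prd_apply, Fin.sum_univ_three, adaptedBasis] <;> ring

/-- The argument of `hasNormalForm_of_eigenvector_fst` with `e₁` and `e₂` exchanged: the eigenvector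
is `e₂` and the form depends on `e₁e₁`. -/
theorem hasNormalForm_of_eigenvector_snd
    {t α β c x y z n₀ n₁ τ : ℂ} (h : IsTableOn l M)
    (hM : M =
      ![![![α, β, c], ![0, 0, 0], ![x, y, z]],
        ![![0, 0, 0], ![0, 0, 0], ![0, t, 0]],
        ![![x + 1, y, z], ![0, t + l, 0], ![n₀, n₁, τ]]]) :
    HasNormalForm l (CharAlg M) := by
  have hE := h.leftSymm
  have e0101 := hE 0 1 0 1
  have e0121 := hE 0 1 2 1
  have e2000 := hE 2 0 0 0
  have e2001 := hE 2 0 0 1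
  have e2002 := hE 2 0 0 2
  have e2010 := hE 2 0 1 0
  have e2011 := hE 2 0 1 1
  have e2012 := hE 2 0 1 2
  have e2020 := hE 2 0 2 0
  have e2021 := hE 2 0 2 1
  have e2022 := hE 2 0 2 2
  have e2100 := hE 2 1 0 0
  have e2101 := hE 2 1 0 1
  have e2102 := hE 2 1 0 2
  have e2110 := hE 2 1 1 0
  have e2111 := hE 2 1 1 1
  have e2112 := hE 2 1 1 2
  have e2120 := hE 2 1 2 0
  have e2121 := hE 2 1 2 1
  have e2122 := hE 2 1 2 2
  simp [assocCoord, Fin.sum_univ_three, hM] at e0101 e0121 e2000 e2001 e2002 e2010 e2011 e2012 e2020 e2021 e2022 e2100 e2101 e2102 e2110 e2111 e2112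
  simp [assocCoord, Fin.sum_univ_three, hM] at e2120 e2121 e2122
  have hz : z = -α := by grind
  subst hz
  by_cases hc : c = 0
  · subst hc
    have hα : α = 0 := by grind
    subst hα
    by_cases hβ : β = 0
    · subst hβ
      refine Or.inr (Or.inl ⟨x, 0, y, t, τ, n₀, n₁, by grind, by grind, by grind, by grind, ?_⟩)
      refine AlgIso.of_eq ?_
      rw [hM]
      funext i j k
      fin_cases i <;> fin_cases j <;> fin_cases k <;> simp [typeB]
    · refine Or.inr (Or.inr (Or.inr (Or.inl ⟨t, x, τ, (n₁ - 2 * y * y / β + y * y / β) / β,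
        by grind, by grind, by grind, ?_⟩)))
      refine (algIso_adaptedTable M one_ne_zero hβ (-y / β) 0).trans (AlgIso.of_eq ?_)
      rw [hM]
      funext i j k
      fin_cases i <;> fin_cases j <;> fin_cases k <;>
        simp [typeD, LSA.adaptedTable, prd_apply, Fin.sum_univ_three, adaptedBasis] <;> grind
  · obtain ⟨a, rfl⟩ : ∃ a, α = a * c := ⟨α / c, by field_simp⟩
    obtain ⟨b, rfl⟩ : ∃ b, β = b * c := ⟨β / c, by field_simp⟩
    have ht : t = 0 := by grind
    subst ht
    have hx : x = -(a * a * c) := by grind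
    subst hx
    have hτ : τ = 2 + a * a * c := by grind
    subst hτ
    have hn₀ : n₀ = a * (1 + a * a * c) := by grind
    subst hn₀
    have hn₁ : n₁ = b * (2 - l - a * a * c) - 2 * a * y := by grind
    subst hn₁
    refine Or.inr (Or.inr (Or.inr (Or.inr (Or.inr ⟨a * b * c + y, c, hc, ?_⟩))))
    refine (algIso_adaptedTable M one_ne_zero one_ne_zero a b).trans (AlgIso.of_eq ?_)
    rw [hM]
    funext i j k
    fin_cases i <;> fin_cases j <;> fin_cases k <;>
      simp [typeF, LSA.adaptedTable, prd_apply, Fin.sum_univ_three, adaptedBasis] <;> ring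

end LSA

/-! ### Normal form according to the position of the eigenvector -/

namespace LSA

open CharAlg

variable {l : ℂ} {M : Fin 3 → Fin 3 → Fin 3 → ℂ}

/-- Dividing `v` by its third coordinate gives an admissible new `e₃`, which `e₁, e₂` annihilate
from the left and which satisfies `e₃e₃ = μ e₃`. -/
theorem IsTableOn.hasNormalForm_of_third_ne_zero (hl0 : l ≠ 0) (hl2 : l ≠ 2) (h : IsTableOn l M)
    {v : Fin 3 → ℂ} {μ : ℂ} (hv0 : ∀ k, ∑ n, v n * M 0 n k = 0)
    (hv1 : ∀ k, ∑ n, v n * M 1 n k = 0) (hv2 : ∀ k, ∑ n, v n * M 2 n k = μ * v k)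
    (hv : v 2 ≠ 0) : HasNormalForm l (CharAlg M) := by
  have h' := h.adaptedTable one_ne_zero one_ne_zero (v 0 / v 2) (v 1 / v 2)
  refine HasNormalForm.of_algIso
    (algIso_adaptedTable M one_ne_zero one_ne_zero (v 0 / v 2) (v 1 / v 2)) ?_
  simp only [Fin.sum_univ_three] at hv0 hv1 hv2
  have y0 : ∀ k, LSA.adaptedTable M 1 1 (v 0 / v 2) (v 1 / v 2) 0 2 k = 0 := by
    have : ∀ k, v 0 / v 2 * M 0 0 k + v 1 / v 2 * M 0 1 k + M 0 2 k = 0 := fun k => by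
      field_simp
      linear_combination hv0 k
    intro k
    fin_cases k <;>
      simp [LSA.adaptedTable, adaptedBasis, prd_apply, Fin.sum_univ_three, this]
  have y1 : ∀ k, LSA.adaptedTable M 1 1 (v 0 / v 2) (v 1 / v 2) 1 2 k = 0 := by
    have : ∀ k, v 0 / v 2 * M 1 0 k + v 1 / v 2 * M 1 1 k + M 1 2 k = 0 := fun k => by
      field_simp
      linear_combination hv1 k
    intro k
    fin_cases k <;>
      simp [LSA.adaptedTable, adaptedBasis, prd_apply, Fin.sum_univ_three, this]
  have y2 : ∀ k, LSA.adaptedTable M 1 1 (v 0 / v 2) (v 1 / v 2) 2 2 k = ![0, 0, μ] k := by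
    have : ∀ k, prd M (LSA.adaptedBasis 1 1 (v 0 / v 2) (v 1 / v 2) 2)
        (LSA.adaptedBasis 1 1 (v 0 / v 2) (v 1 / v 2) 2) k = μ * v k / v 2 := fun k => by
      simp only [prd_apply, adaptedBasis, Fin.sum_univ_three]
      simp
      field_simp
      linear_combination v 0 * hv0 k + v 1 * hv1 k + v 2 * hv2 k
    intro k
    fin_cases k <;> simp [LSA.adaptedTable, this, hv] <;> field_simp <;> simp
  generalize LSA.adaptedTable M 1 1 (v 0 / v 2) (v 1 / v 2) = M' at *
  refine hasNormalForm_of_annihilated hl0 hl2 h' (x₀ := M' 0 0 0) (x₁ := M' 0 0 1)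
    (x₂ := M' 0 0 2) (y₀ := M' 0 1 0) (y₁ := M' 0 1 1) (y₂ := M' 0 1 2) (z₀ := M' 1 1 0)
    (z₁ := M' 1 1 1) (z₂ := M' 1 1 2) (μ := μ) ?_
  funext i j k
  fin_cases i <;> fin_cases j <;> fin_cases k <;>
    simp [y0, y1, y2, h'.comm01, h'.comm20, h'.comm21, e₁, e₂]

/-- Scaling `e₁` and `e₂` by the coordinates of `v` turns `v` into `e₁ + e₂`. -/
theorem IsTableOn.hasNormalForm_of_fst_snd_ne_zero (hl1 : l ≠ 1) (h : IsTableOn l M)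
    {v : Fin 3 → ℂ} {μ : ℂ} (hv0 : ∀ k, ∑ n, v n * M 0 n k = 0)
    (hv1 : ∀ k, ∑ n, v n * M 1 n k = 0) (hv2 : ∀ k, ∑ n, v n * M 2 n k = μ * v k)
    (hv : v 2 = 0) (hu : v 0 ≠ 0) (hw : v 1 ≠ 0) : HasNormalForm l (CharAlg M) := by
  have h' := h.adaptedTable hu hw 0 0
  refine HasNormalForm.of_algIso (algIso_adaptedTable M hu hw 0 0) ?_
  simp only [Fin.sum_univ_three, hv, zero_mul, add_zero] at hv0 hv1 hv2
  have y0 : ∀ k, LSA.adaptedTable M (v 0) (v 1) 0 0 0 1 k =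
      -LSA.adaptedTable M (v 0) (v 1) 0 0 0 0 k := by
    intro k
    fin_cases k <;>
      simp [LSA.adaptedTable, adaptedBasis, prd_apply, Fin.sum_univ_three] <;> field_simp
    · linear_combination hv0 0
    · linear_combination hv0 1
    · linear_combination hv0 2
  have y1 : ∀ k, LSA.adaptedTable M (v 0) (v 1) 0 0 1 1 k =
      LSA.adaptedTable M (v 0) (v 1) 0 0 0 0 k := by
    intro k
    have := h'.comm01 k
    rw [y0] at this
    rw [← neg_neg (LSA.adaptedTable M (v 0) (v 1) 0 0 0 0 k), ← this]
    fin_cases k <;>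
      simp [LSA.adaptedTable, adaptedBasis, prd_apply, Fin.sum_univ_three] <;> field_simp
    · linear_combination hv1 0
    · linear_combination hv1 1
    · linear_combination hv1 2
  have y2 : ∀ k, LSA.adaptedTable M (v 0) (v 1) 0 0 2 1 k =
      ![μ, μ, 0] k - LSA.adaptedTable M (v 0) (v 1) 0 0 2 0 k := by
    intro k
    fin_cases k <;>
      simp [LSA.adaptedTable, adaptedBasis, prd_apply, Fin.sum_univ_three] <;> field_simp
    · linear_combination hv2 0
    · linear_combination hv2 1
    · linear_combination hv2 2 + μ * hv
  have y3 : ∀ k, LSA.adaptedTable M (v 0) (v 1) 0 0 1 2 k =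
      ![μ, μ, 0] k - LSA.adaptedTable M (v 0) (v 1) 0 0 2 0 k - l * e₂ k := fun k => by
    rw [← y2, h'.comm21]
    ring
  generalize LSA.adaptedTable M (v 0) (v 1) 0 0 = M' at *
  refine hasNormalForm_of_eigenvector_add hl1 h' (q₀ := M' 0 0 0) (q₁ := M' 0 0 1)
    (q₂ := M' 0 0 2) (p₀ := M' 0 2 0) (p₁ := M' 0 2 1) (p₂ := M' 0 2 2) (μ := μ)
    (n₀ := M' 2 2 0) (n₁ := M' 2 2 1) (τ := M' 2 2 2) ?_
  funext i j k
  fin_cases i <;> fin_cases j <;> fin_cases k <;>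
    simp [y0, y1, y2, y3, h'.comm01, h'.comm20, e₁, e₂] <;> ring

theorem IsTableOn.hasNormalForm (hl0 : l ≠ 0) (hl1 : l ≠ 1) (hl2 : l ≠ 2) (h : IsTableOn l M) :
    HasNormalForm l (CharAlg M) := by
  obtain ⟨v, μ, hne, hv0, hv1, hv2⟩ := h.exists_eigenvector hl0
  by_cases h2 : v 2 = 0
  swap
  · exact h.hasNormalForm_of_third_ne_zero hl0 hl2 hv0 hv1 hv2 h2
  by_cases hu : v 0 = 0
  · have hw : v 1 ≠ 0 := fun hw => hne (by funext k; fin_cases k <;> simp [*])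
    simp only [Fin.sum_univ_three, hu, h2, zero_mul, add_zero, zero_add] at hv0 hv1 hv2
    have y0 : ∀ k, M 0 1 k = 0 := fun k => by simpa [hw] using hv0 k
    have y1 : ∀ k, M 1 1 k = 0 := fun k => by simpa [hw] using hv1 k
    have y2 : ∀ k, M 1 2 k = ![0, μ - l, 0] k := by
      intro k
      have hk := hv2 k
      rw [h.comm21] at hk
      fin_cases k <;> simp [e₂, hw, hu, h2] at hk ⊢
      · exact hk
      · have : v 1 * (M 1 2 1 - (μ - l)) = 0 := by linear_combination hk
        simpa [hw, sub_eq_zero] using this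
      · exact hk
    refine hasNormalForm_of_eigenvector_snd h (t := μ - l) (α := M 0 0 0) (β := M 0 0 1)
      (c := M 0 0 2) (x := M 0 2 0) (y := M 0 2 1) (z := M 0 2 2) (n₀ := M 2 2 0)
      (n₁ := M 2 2 1) (τ := M 2 2 2) ?_
    funext i j k
    fin_cases i <;> fin_cases j <;> fin_cases k <;>
      simp [y0, y1, y2, h.comm01, h.comm20, h.comm21, e₁, e₂]
  by_cases hw : v 1 = 0
  · simp only [Fin.sum_univ_three, hw, h2, zero_mul, add_zero] at hv0 hv1 hv2
    have y0 : ∀ k, M 0 0 k = 0 := fun k => by simpa [hu] using hv0 k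
    have y1 : ∀ k, M 0 1 k = 0 := fun k => by simpa [hu, h.comm01] using hv1 k
    have y2 : ∀ k, M 0 2 k = ![μ - 1, 0, 0] k := by
      intro k
      have hk := hv2 k
      rw [h.comm20] at hk
      fin_cases k <;> simp [e₁, hw, hu, h2] at hk ⊢
      · have : v 0 * (M 0 2 0 - (μ - 1)) = 0 := by linear_combination hk
        simpa [hu, sub_eq_zero] using this
      · exact hk
      · exact hk
    refine hasNormalForm_of_eigenvector_fst hl0 h (t := μ - 1) (α := M 1 1 0) (β := M 1 1 1)
      (c := M 1 1 2) (x := M 1 2 0) (y := M 1 2 1) (z := M 1 2 2) (n₀ := M 2 2 0)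
      (n₁ := M 2 2 1) (τ := M 2 2 2) ?_
    funext i j k
    fin_cases i <;> fin_cases j <;> fin_cases k <;>
      simp [y0, y1, y2, h.comm01, h.comm20, h.comm21, e₁, e₂]
  · exact h.hasNormalForm_of_fst_snd_ne_zero hl1 hv0 hv1 hv2 h2 hu hw

theorem IsLeftSymmetricOn.hasNormalForm {A : Type*} [NonUnitalNonAssocRing A] [Module ℂ A]
    [IsScalarTower ℂ A A] [SMulCommClass ℂ A A] (hl0 : l ≠ 0) (hl1 : l ≠ 1) (hl2 : l ≠ 2)
    (h : IsLeftSymmetricOn A l) : HasNormalForm l A := by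
  obtain ⟨M, hM, hiso⟩ := h.exists_isTableOn
  exact HasNormalForm.of_algIso hiso (hM.hasNormalForm hl0 hl1 hl2)

/-! ### Values excluded by the range of `l` -/

theorem Param.norm_le_one (h : Param l) : ‖l‖ ≤ 1 := by
  rcases h with h | ⟨θ, _, _, rfl⟩
  · exact h.2.le
  · rw [Complex.norm_exp_ofReal_mul_I]

theorem Param.ne_zero (h : Param l) : l ≠ 0 := by
  rcases h with h | ⟨θ, _, _, rfl⟩
  · exact norm_pos_iff.1 h.1
  · exact Complex.exp_ne_zero _

theorem Param.ne_one (h : Param l) : l ≠ 1 := by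
  rcases h with h | ⟨θ, h0, h1, rfl⟩
  · rintro rfl
    simp at h
  · intro h
    rw [Complex.exp_eq_one_iff] at h
    obtain ⟨n, hn⟩ := h
    have h2 : (θ : ℂ) = n * (2 * Real.pi) :=
      mul_right_cancel₀ Complex.I_ne_zero (by linear_combination hn)
    have h3 : θ = n * (2 * Real.pi) := by exact_mod_cast h2
    have hpi := Real.pi_pos
    have hn0 : 0 < n := by
      by_contra! hle
      have : (n : ℝ) ≤ 0 := by exact_mod_cast hle
      nlinarith
    have : (1 : ℝ) ≤ n := by exact_mod_cast hn0
    nlinarith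

theorem Param.ne_two (h : Param l) : l ≠ 2 := by
  rintro rfl
  have := h.norm_le_one
  norm_num at this

/-- Needed for bi-symmetry, where `l = 3` would be the exceptional value in `typeB` and `typeD`. -/
theorem Param.ne_three (h : Param l) : l ≠ 3 := by
  rintro rfl
  have := h.norm_le_one
  norm_num at this

end LSA

namespace LSA

open CharAlg

/-! ### The named algebras as normal forms -/

variable (l t : ℂ)

theorem D1_eq_typeA : D1 l t = typeA l t 0 0 0 0 := by
  funext i j k
  fin_cases i <;> fin_cases j <;> fin_cases k <;> simp [D1, typeA, e₁, e₂, e₃]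

theorem D10_eq_typeA : D10 l = typeA l (1 + l) 0 0 1 0 := by
  funext i j k
  fin_cases i <;> fin_cases j <;> fin_cases k <;> simp [D10, typeA, e₁, e₂, e₃, add_comm]

theorem DS1_eq_typeA : DS1 t = typeA (1 / 2) t 0 1 0 0 := by
  funext i j k
  fin_cases i <;> fin_cases j <;> fin_cases k <;> simp [DS1, typeA, e₁, e₂, e₃]

theorem DS7_eq_typeA : DS7 = typeA (1 / 2) (1 + 1 / 2) 0 1 1 0 := by
  funext i j k
  fin_cases i <;> fin_cases j <;> fin_cases k <;> simp [DS7, typeA, e₁, e₂, e₃]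
  norm_num

theorem D4_eq_typeB : D4 (-1) 1 = typeB (-1) 0 0 0 1 1 0 0 := by
  funext i j k
  fin_cases i <;> fin_cases j <;> fin_cases k <;> simp [D4, typeB, e₁, e₂, e₃]

theorem D5_eq_typeB : D5 (-1) = typeB (-1) 0 0 0 1 1 0 1 := by
  funext i j k
  fin_cases i <;> fin_cases j <;> fin_cases k <;> simp [D5, typeB, e₁, e₂, e₃]

theorem D8_eq_typeB : D8 (-1) = typeB (-1) 0 0 0 1 1 1 0 := by
  funext i j k
  fin_cases i <;> fin_cases j <;> fin_cases k <;> simp [D8, typeB, e₁, e₂, e₃]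

theorem DT1_eq_typeB : DT1 = typeB (-1) 0 0 0 1 1 1 1 := by
  funext i j k
  fin_cases i <;> fin_cases j <;> fin_cases k <;> simp [DT1, typeB, e₁, e₂, e₃]

theorem D11_eq_typeB : D11 l t = typeB l t 0 0 t t 0 0 := by
  funext i j k
  fin_cases i <;> fin_cases j <;> fin_cases k <;> simp [D11, typeB, e₁, e₂, e₃]

theorem D12_eq_typeB : D12 l = typeB l (-1) 0 0 (-1) (-1) 1 0 := by
  funext i j k
  fin_cases i <;> fin_cases j <;> fin_cases k <;> simp [D12, typeB, e₁, e₂, e₃]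
  ring

theorem D13_eq_typeB : D13 l = typeB l (-l) 0 0 (-l) (-l) 0 1 := by
  funext i j k
  fin_cases i <;> fin_cases j <;> fin_cases k <;> simp [D13, typeB, e₁, e₂, e₃]
  ring

theorem D14_eq_typeB : D14 (1 / 2) = typeB (1 / 2) (-1 / 2) 1 0 (-1 / 2) (-1 / 2) 0 0 := by
  funext i j k
  fin_cases i <;> fin_cases j <;> fin_cases k <;> simp [D14, typeB, e₁, e₂, e₃] <;> norm_num

theorem DS4_eq_typeB : DS4 = typeB (1 / 2) (-1 / 2) 1 0 (-1 / 2) (-1 / 2) 0 1 := by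
  funext i j k
  fin_cases i <;> fin_cases j <;> fin_cases k <;> simp [DS4, typeB, e₁, e₂, e₃] <;> norm_num

theorem DS5_eq_typeC : DS5 t = typeC (1 / 2) t t t 0 := by
  funext i j k
  fin_cases i <;> fin_cases j <;> fin_cases k <;> simp [DS5, typeC, e₁, e₂, e₃]

theorem DS6_eq_typeC : DS6 = typeC (1 / 2) (-1) (-1) (-1) 1 := by
  funext i j k
  fin_cases i <;> fin_cases j <;> fin_cases k <;> simp [DS6, typeC, e₁, e₂, e₃] <;> norm_num

/-! ### Changes of basis between normal forms -/

variable {l t}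

theorem algIso_of_adaptedTable {M M' : Fin 3 → Fin 3 → Fin 3 → ℂ} {u w : ℂ} (hu : u ≠ 0)
    (hw : w ≠ 0) (a b : ℂ) (h : adaptedTable M u w a b = M') :
    AlgIso (CharAlg M) (CharAlg M') :=
  (algIso_adaptedTable M hu hw a b).trans (AlgIso.of_eq h)

theorem algIso_typeA_scale {μ a b c d : ℂ} {u w : ℂ} (hu : u ≠ 0) (hw : w ≠ 0) :
    AlgIso (CharAlg (typeA l μ a b c d))
      (CharAlg (typeA l μ (u ^ 2 * a) (w ^ 2 * b / u) (u * w * c) (w ^ 2 * d))) := by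
  refine algIso_of_adaptedTable hu hw 0 0 ?_
  funext i j k
  fin_cases i <;> fin_cases j <;> fin_cases k <;>
    simp [typeA, adaptedTable, prd_apply, Fin.sum_univ_three, adaptedBasis] <;>
    grind

/-- The shift `a` or `b` removes `n₁` or `n₂` when its coefficient `2p + 1 - τ` or `2s + l - τ` is
nonzero; otherwise, in the diagonal case, that entry can only be rescaled. -/
theorem algIso_typeB_shift {p q r s τ n₁ n₂ : ℂ} {u w : ℂ} (hu : u ≠ 0) (hw : w ≠ 0) (a b : ℂ) :
    AlgIso (CharAlg (typeB l p q r s τ n₁ n₂))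
      (CharAlg (typeB l p (w * q / u) (u * r / w) s τ
        ((n₁ + (2 * p + 1 - τ) * a + 2 * q * b) / u)
        ((n₂ + (2 * s + l - τ) * b + 2 * r * a) / w))) := by
  refine algIso_of_adaptedTable hu hw a b ?_
  funext i j k
  fin_cases i <;> fin_cases j <;> fin_cases k <;>
    simp [typeB, adaptedTable, prd_apply, Fin.sum_univ_three, adaptedBasis] <;>
    field_simp <;> ring

/-- Keeping `e₂e₂ = e₁` ties the scale of `e₁` to the square of that of `e₂`, and keeping `e₂e₃` a
multiple of `e₂` allows shifts of `e₃` along `e₁` only. -/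
theorem algIso_typeC_shift {y τ n : ℂ} {w : ℂ} (hw : w ≠ 0) (a : ℂ) :
    AlgIso (CharAlg (typeC l t y τ n))
      (CharAlg (typeC l t y τ ((n + (2 * t + 1 - τ) * a) / w ^ 2))) := by
  refine algIso_of_adaptedTable (pow_ne_zero 2 hw) hw a 0 ?_
  funext i j k
  fin_cases i <;> fin_cases j <;> fin_cases k <;>
    simp [typeC, adaptedTable, prd_apply, Fin.sum_univ_three, adaptedBasis] <;>
    field_simp <;> ring

/-- The automorphism of `D_{-1}` exchanging `e₁` and `e₂` and changing the sign of `e₃`. -/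
theorem algIso_typeB_swap (n₁ n₂ : ℂ) :
    AlgIso (CharAlg (typeB (-1) (-1) 0 0 0 (-1) n₁ n₂))
      (CharAlg (typeB (-1) 0 0 0 1 1 n₂ n₁)) := by
  refine algIso_of_basis ![![0, 1, 0], ![1, 0, 0], ![0, 0, -1]]
    (by simp [Matrix.det_fin_three]) fun i j k => ?_
  fin_cases i <;> fin_cases j <;> fin_cases k <;>
    simp [typeB, prd_apply, Fin.sum_univ_three]

end LSA

namespace LSA

open CharAlg

variable {l : ℂ} {A : Type*} [NonUnitalNonAssocRing A] [Module ℂ A]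

/-! ### Associative algebras -/

theorem HasNormalForm.algIso_of_isAssoc (hl0 : l ≠ 0) (hl1 : l ≠ 1) (hl2 : l ≠ 2)
    (h : HasNormalForm l A) (hA : IsAssoc A) : l = -1 ∧ AlgIso A (CharAlg (D4 (-1) 1)) := by
  rcases h with ⟨μ, a, b, c, d, h1, h2, h3, h4, h5, h6⟩ |
    ⟨p, q, r, s, τ, n₁, n₂, h1, h2, h3, h4, h5⟩ | ⟨t, y, τ, n, h1, h2, h3, h4⟩ |
    ⟨t, y, τ, n, h1, h2, h3, h4⟩ | ⟨x, d, h1, h2⟩ | ⟨x, d, h1, h2⟩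
  · have e := assocCoord_of_isAssoc (hA.of_algIso h6)
    -- From `(e₃e₃)eᵢ = e₃(e₃eᵢ)` for `i = 1, 2` one gets `μ = 1` and `μ l = l²`, impossible for `l
    -- ≠ 0, 1`.
    have e1 := e 2 2 0 0
    have e2 := e 2 2 1 1
    simp [assocCoord, Fin.sum_univ_three, typeA] at e1 e2
    grind
  · have e := assocCoord_of_isAssoc (hA.of_algIso h5)
    have e1 := e 2 2 0 0
    have e2 := e 2 2 1 1
    have e3 := e 0 2 2 0
    have e4 := e 0 2 2 1
    have e5 := e 1 2 2 0
    have e6 := e 1 2 2 1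
    have e7 := e 2 2 2 0
    have e8 := e 2 2 2 1
    simp [assocCoord, Fin.sum_univ_three, typeB] at e1 e2 e3 e4 e5 e6 e7 e8
    have hl1' : 1 - l ≠ 0 := sub_ne_zero.2 hl1.symm
    -- The associativity and left-symmetry equations for this entry differ exactly by `(1 - l) q`.
    have hq : q = 0 := by
      have : (1 - l) * q = 0 := by linear_combination h2 - e5
      simpa [hl1'] using this
    have hr : r = 0 := by
      have : (1 - l) * r = 0 := by linear_combination e4 - h3
      simpa [hl1'] using this
    subst hq hr
    have hn₁ : n₁ = 0 := by grind
    have hn₂ : n₂ = 0 := by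
      have : l * n₂ = 0 := by linear_combination -e8
      simpa [hl0] using this
    subst hn₁ hn₂
    -- Both `p` and `p + 1` lie in `{0, τ}`, and so do `s` and `s + l`. Hence `1` and `l` are both
    -- `±τ`, and `l ≠ 1` leaves `l = -1`.
    have hp : p = 0 ∨ p = τ := by grind
    have hs : s = 0 ∨ s = τ := by grind
    have hl : l = -1 := by grind
    subst hl
    refine ⟨rfl, h5.trans ?_⟩
    rw [D4_eq_typeB]
    have : (p = 0 ∧ s = 1 ∧ τ = 1) ∨ (p = -1 ∧ s = 0 ∧ τ = -1) := by grind
    rcases this with ⟨rfl, rfl, rfl⟩ | ⟨rfl, rfl, rfl⟩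
    · exact AlgIso.of_eq rfl
    · exact algIso_typeB_swap 0 0
  · have e := assocCoord_of_isAssoc (hA.of_algIso h4)
    have e1 := e 1 1 2 0
    have e2 := e 2 1 1 0
    simp [assocCoord, Fin.sum_univ_three, typeC] at e1 e2
    grind
  · have e := assocCoord_of_isAssoc (hA.of_algIso h4)
    have e1 := e 0 0 2 1
    simp [assocCoord, Fin.sum_univ_three, typeD] at e1
    grind
  · have e := assocCoord_of_isAssoc (hA.of_algIso h2)
    have e1 := e 1 1 1 1
    simp [assocCoord, Fin.sum_univ_three, typeE] at e1
    grind
  · have e := assocCoord_of_isAssoc (hA.of_algIso h2)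
    have e1 := e 0 0 0 0
    simp [assocCoord, Fin.sum_univ_three, typeF] at e1
    grind

/-! ### Bi-symmetric algebras -/

/-- Both shift coefficients vanish here, so `n₁` and `n₂` can only be scaled, independently, to `0`
or `1`: four algebras. -/
theorem algIso_typeB_neg_one (n₁ n₂ : ℂ) :
    AlgIso (CharAlg (typeB (-1) 0 0 0 1 1 n₁ n₂)) (CharAlg (D4 (-1) 1)) ∨
      AlgIso (CharAlg (typeB (-1) 0 0 0 1 1 n₁ n₂)) (CharAlg (D5 (-1))) ∨
      AlgIso (CharAlg (typeB (-1) 0 0 0 1 1 n₁ n₂)) (CharAlg (D8 (-1))) ∨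
      AlgIso (CharAlg (typeB (-1) 0 0 0 1 1 n₁ n₂)) (CharAlg DT1) := by
  rw [D4_eq_typeB, D5_eq_typeB, D8_eq_typeB, DT1_eq_typeB]
  by_cases h1 : n₁ = 0 <;> by_cases h2 : n₂ = 0
  · subst h1 h2
    exact Or.inl (AlgIso.of_eq rfl)
  · subst h1
    refine Or.inr (Or.inl ((algIso_typeB_shift one_ne_zero h2 0 0).trans (AlgIso.of_eq ?_)))
    simp [h2]
  · subst h2
    refine Or.inr (Or.inr (Or.inl ((algIso_typeB_shift h1 one_ne_zero 0 0).trans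
      (AlgIso.of_eq ?_))))
    simp [h1]
  · refine Or.inr (Or.inr (Or.inr ((algIso_typeB_shift h1 h2 0 0).trans (AlgIso.of_eq ?_))))
    simp [h1, h2]

theorem HasNormalForm.algIso_of_isBiSymmetric (hl0 : l ≠ 0) (hl1 : l ≠ 1) (hl2 : l ≠ 2)
    (hl3 : l ≠ 3) (h : HasNormalForm l A) (hA : IsBiSymmetric A) :
    l = -1 ∧ (AlgIso A (CharAlg (D4 (-1) 1)) ∨ AlgIso A (CharAlg (D5 (-1))) ∨
      AlgIso A (CharAlg (D8 (-1))) ∨ AlgIso A (CharAlg DT1)) := by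
  suffices h : l = -1 ∧ ∃ n₁ n₂, AlgIso A (CharAlg (typeB (-1) 0 0 0 1 1 n₁ n₂)) by
    obtain ⟨hl, n₁, n₂, hiso⟩ := h
    exact ⟨hl, (algIso_typeB_neg_one n₁ n₂).imp hiso.trans
      (Or.imp hiso.trans (Or.imp hiso.trans hiso.trans))⟩
  rcases h with ⟨μ, a, b, c, d, h1, h2, h3, h4, h5, h6⟩ |
    ⟨p, q, r, s, τ, n₁, n₂, h1, h2, h3, h4, h5⟩ | ⟨t, y, τ, n, h1, h2, h3, h4⟩ |
    ⟨t, y, τ, n, h1, h2, h3, h4⟩ | ⟨x, d, h1, h2⟩ | ⟨x, d, h1, h2⟩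
  · have e := assocCoord_of_isBiSymmetric (hA.of_algIso h6)
    have e1 := e 2 2 0 0
    have e2 := e 2 2 1 1
    simp [assocCoord, Fin.sum_univ_three, typeA] at e1 e2
    grind
  · have e := assocCoord_of_isBiSymmetric (hA.of_algIso h5)
    have e1 := e 2 2 0 0
    have e2 := e 2 2 0 1
    have e3 := e 2 2 1 0
    have e4 := e 2 2 1 1
    simp [assocCoord, Fin.sum_univ_three, typeB] at e1 e2 e3 e4
    have hr : r = 0 := by
      have : r * (3 - l) = 0 := by linear_combination -e2 - h3
      simpa [sub_eq_zero, hl3.symm] using this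
    subst hr
    -- With `r = 0` the associators `(e₃, eᵢ, e₃)` contribute nothing to the diagonal entries, so
    -- the eigenvalue argument of the associative case applies.
    have hp : p = 0 ∨ p = τ := by grind
    have hs : s = 0 ∨ s = τ := by grind
    have hl : l = -1 := by grind
    subst hl
    have hq : q = 0 := by grind
    subst hq
    have : (p = 0 ∧ s = 1 ∧ τ = 1) ∨ (p = -1 ∧ s = 0 ∧ τ = -1) := by grind
    rcases this with ⟨rfl, rfl, rfl⟩ | ⟨rfl, rfl, rfl⟩
    · exact ⟨rfl, n₁, n₂, h5⟩
    · exact ⟨rfl, n₂, n₁, h5.trans (algIso_typeB_swap n₁ n₂)⟩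
  · have e := assocCoord_of_isBiSymmetric (hA.of_algIso h4)
    have e1 := e 1 1 2 0
    have e2 := e 2 2 0 0
    have e3 := e 2 2 1 1
    simp [assocCoord, Fin.sum_univ_three, typeC] at e1 e2 e3
    grind
  · have e := assocCoord_of_isBiSymmetric (hA.of_algIso h4)
    have e1 := e 0 0 2 1
    simp [assocCoord, Fin.sum_univ_three, typeD] at e1
    grind
  · have e := assocCoord_of_isBiSymmetric (hA.of_algIso h2)
    have e1 := e 1 1 2 2
    simp [assocCoord, Fin.sum_univ_three, typeE] at e1
    grind
  · have e := assocCoord_of_isBiSymmetric (hA.of_algIso h2)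
    have e1 := e 0 0 2 2
    simp [assocCoord, Fin.sum_univ_three, typeF] at e1
    grind

/-! ### Simple algebras -/

theorem HasNormalForm.algIso_of_isSimpleAlg (hl0 : l ≠ 0) (hl1 : l ≠ 1)
    (h : HasNormalForm l A) (hA : IsSimpleAlg A) :
    AlgIso A (CharAlg (D10 l)) ∨ (l = 1 / 2 ∧ AlgIso A (CharAlg DS7)) := by
  rcases h with ⟨μ, a, b, c, d, h1, h2, h3, h4, h5, h6⟩ |
    ⟨p, q, r, s, τ, n₁, n₂, h1, h2, h3, h4, h5⟩ | ⟨t, y, τ, n, h1, h2, h3, h4⟩ |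
    ⟨t, y, τ, n, h1, h2, h3, h4⟩ | ⟨x, d, h1, h2⟩ | ⟨x, d, h1, h2⟩
  · have hA' := hA.of_algIso h6
    by_cases hc : c = 0
    · exfalso
      subst hc
      by_cases ha : a = 0
      · subst ha
        refine not_isSimpleAlg_of_coord {1, 2} 1 0 (by simp) (by simp) ?_ hA'
        simp [Fin.forall_fin_succ, typeA]
      · have hb : b = 0 := by grind
        have hd : d = 0 := by grind
        subst hb hd
        refine not_isSimpleAlg_of_coord {0, 2} 0 1 (by simp) (by simp) ?_ hA'
        simp [Fin.forall_fin_succ, typeA]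
    · have hμ : μ = 1 + l := by grind
      subst hμ
      have ha : a = 0 := by grind
      have hd : d = 0 := by grind
      subst ha hd
      by_cases hb : b = 0
      · left
        subst hb
        refine h6.trans ((algIso_typeA_scale (inv_ne_zero hc) one_ne_zero).trans
          (AlgIso.of_eq ?_))
        simp [D10_eq_typeA, hc]
      · right
        have hl : l = 1 / 2 := by grind
        subst hl
        -- The scaling must satisfy `w² b / u = 1` and `u w c = 1`, that is `u = w² b` and `w³ =
        -- (bc)⁻¹`.
        obtain ⟨w, hw⟩ := IsAlgClosed.exists_pow_nat_eq (b * c)⁻¹ (n := 3) (by norm_num)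
        have hw0 : w ≠ 0 := by
          rintro rfl
          simp [hb, hc] at hw
        refine ⟨rfl, h6.trans ((algIso_typeA_scale (u := w ^ 2 * b) (w := w)
          (mul_ne_zero (pow_ne_zero 2 hw0) hb) hw0).trans (AlgIso.of_eq ?_))⟩
        have h1 : w ^ 2 * b / (w ^ 2 * b) = 1 :=
          div_self (mul_ne_zero (pow_ne_zero 2 hw0) hb)
        have h2 : w ^ 2 * b * w * c = 1 := by
          calc w ^ 2 * b * w * c = w ^ 3 * (b * c) := by ring
            _ = 1 := by rw [hw, inv_mul_cancel₀ (mul_ne_zero hb hc)]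
        rw [DS7_eq_typeA, h1, h2, mul_zero, mul_zero]
  -- Every other form has a visible ideal: the span of `e₁, e₂` in `typeB`, the line of `e₁` in
  -- `typeC` and `typeE`, the line of `e₂` in `typeD` and `typeF`.
  all_goals exfalso
  · refine not_isSimpleAlg_of_coord {2} 2 0 (by simp) (by simp) ?_ (hA.of_algIso h5)
    simp [Fin.forall_fin_succ, typeB]
  · refine not_isSimpleAlg_of_coord {1, 2} 1 0 (by simp) (by simp) ?_ (hA.of_algIso h4)
    simp [Fin.forall_fin_succ, typeC]
  · refine not_isSimpleAlg_of_coord {0, 2} 0 1 (by simp) (by simp) ?_ (hA.of_algIso h4)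
    simp [Fin.forall_fin_succ, typeD]
  · refine not_isSimpleAlg_of_coord {1, 2} 1 0 (by simp) (by simp) ?_ (hA.of_algIso h2)
    simp [Fin.forall_fin_succ, typeE]
  · refine not_isSimpleAlg_of_coord {0, 2} 0 1 (by simp) (by simp) ?_ (hA.of_algIso h2)
    simp [Fin.forall_fin_succ, typeF]

end LSA

namespace LSA

open CharAlg

variable {l : ℂ} {A : Type*} [NonUnitalNonAssocRing A] [Module ℂ A]

/-! ### Transitive algebras -/

/-- Transitivity kills the `e₃` coefficient of `e₃e₃` in every form. This is impossible for `typeE`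
(`2l`) and `typeF` (`2`), and in `typeD` it would force `l = 2`. -/
theorem HasNormalForm.algIso_of_isTransitive [IsScalarTower ℂ A A] (hl0 : l ≠ 0) (hl1 : l ≠ 1)
    (hl2 : l ≠ 2) (h : HasNormalForm l A) (hA : IsTransitive A) :
    AlgIso A (CharAlg (D1 l 0)) ∨ (l = -1 ∧ AlgIso A (CharAlg (D10 (-1)))) ∨
      (l = 1 / 2 ∧ AlgIso A (CharAlg (DS1 0))) := by
  rcases h with ⟨μ, a, b, c, d, h1, h2, h3, h4, h5, h6⟩ |
    ⟨p, q, r, s, τ, n₁, n₂, h1, h2, h3, h4, h5⟩ | ⟨t, y, τ, n, h1, h2, h3, h4⟩ |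
    ⟨t, y, τ, n, h1, h2, h3, h4⟩ | ⟨x, d, h1, h2⟩ | ⟨x, d, h1, h2⟩
  · have hμ : μ = 0 := by
      simpa [typeA] using eq_zero_of_isTransitive (hA.of_algIso h6) (by simp [typeA])
        (by simp [typeA])
    subst hμ
    have ha : a = 0 := by grind
    have hd : d = 0 := by grind
    subst ha hd
    by_cases hc : c = 0
    · subst hc
      by_cases hb : b = 0
      · subst hb
        exact Or.inl (h6.trans (AlgIso.of_eq (D1_eq_typeA l 0).symm))
      · have hl : l = 1 / 2 := by grind
        subst hl
        refine Or.inr (Or.inr ⟨rfl, h6.trans ((algIso_typeA_scale hb one_ne_zero).trans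
          (AlgIso.of_eq ?_))⟩)
        simp [DS1_eq_typeA, hb]
    · have hl : l = -1 := by grind
      subst hl
      have hb : b = 0 := by grind
      subst hb
      refine Or.inr (Or.inl ⟨rfl, h6.trans ((algIso_typeA_scale (inv_ne_zero hc)
        one_ne_zero).trans (AlgIso.of_eq ?_))⟩)
      simp [D10_eq_typeA, hc]
  · have hτ : τ = 0 := by
      simpa [typeB] using eq_zero_of_isTransitive (hA.of_algIso h5) (by simp [typeB])
        (by simp [typeB])
    subst hτ
    have hl1' : 1 - l ≠ 0 := sub_ne_zero.2 hl1.symm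
    have hqr : q * r = 0 := by
      have : q * r * (2 * (1 - l)) = 0 := by linear_combination r * h2 - q * h3
      simpa [hl1', or_assoc] using this
    have hp : p = 0 := by simpa [hqr] using h1
    have hs : s = 0 := by simpa [hqr] using h4
    subst hp hs
    have hq : q = 0 := by simpa [hl1'] using h2
    have hr : r = 0 := by simpa [hl1'] using h3
    subst hq hr
    refine Or.inl (h5.trans ((algIso_typeB_shift one_ne_zero one_ne_zero (-n₁) (-n₂ / l)).trans
      (AlgIso.of_eq ?_)))
    rw [D1_eq_typeA]
    funext i j k
    fin_cases i <;> fin_cases j <;> fin_cases k <;> simp [typeA, typeB]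
    field_simp
    ring
  · have hτ : τ = 0 := by
      simpa [typeC] using eq_zero_of_isTransitive (hA.of_algIso h4) (by simp [typeC])
        (by simp [typeC])
    subst hτ
    have ht : t = 0 := by simpa using h1
    have hy : y = 0 := by simpa using h2
    have hl : l = 1 / 2 := by grind
    subst ht hy hl
    refine Or.inr (Or.inr ⟨rfl, h4.trans ((algIso_typeC_shift one_ne_zero (-n)).trans
      (AlgIso.of_eq ?_))⟩)
    rw [DS1_eq_typeA]
    funext i j k
    fin_cases i <;> fin_cases j <;> fin_cases k <;> simp [typeA, typeC]
  · have hτ : τ = 0 := by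
      simpa [typeD] using eq_zero_of_isTransitive (hA.of_algIso h4) (by simp [typeD])
        (by simp [typeD])
    grind
  · have hτ : 2 * l = 0 := by
      simpa [typeE] using eq_zero_of_isTransitive (hA.of_algIso h2) (by simp [typeE])
        (by simp [typeE])
    grind
  · have hτ : (2 : ℂ) = 0 := by
      simpa [typeF] using eq_zero_of_isTransitive (hA.of_algIso h2) (by simp [typeF])
        (by simp [typeF])
    norm_num at hτ

/-! ### Novikov algebras -/

/-- The shift coefficients are `τ + 1` and `τ + l`, never both zero as `l ≠ 1`. A surviving entry,
scaled to `1`, gives `D12` at `τ = -1` and `D13` at `τ = -l`. -/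
theorem algIso_typeB_diag (hl1 : l ≠ 1) (τ n₁ n₂ : ℂ) :
    AlgIso (CharAlg (typeB l τ 0 0 τ τ n₁ n₂)) (CharAlg (D11 l τ)) ∨
      AlgIso (CharAlg (typeB l τ 0 0 τ τ n₁ n₂)) (CharAlg (D12 l)) ∨
      AlgIso (CharAlg (typeB l τ 0 0 τ τ n₁ n₂)) (CharAlg (D13 l)) := by
  rw [D11_eq_typeB, D12_eq_typeB, D13_eq_typeB]
  by_cases h1 : τ + 1 = 0
  · have hτ : τ = -1 := by linear_combination h1
    subst hτ
    have hl1' : l - 1 ≠ 0 := sub_ne_zero.2 hl1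
    have hb : n₂ + (2 * -1 + l - -1) * (-n₂ / (l - 1)) = 0 := by
      field_simp
      ring
    by_cases hn : n₁ = 0
    · subst hn
      refine Or.inl ((algIso_typeB_shift one_ne_zero one_ne_zero 0 (-n₂ / (l - 1))).trans
        (AlgIso.of_eq ?_))
      rw [hb]
      simp
    · refine Or.inr (Or.inl ((algIso_typeB_shift hn one_ne_zero 0 (-n₂ / (l - 1))).trans
        (AlgIso.of_eq ?_)))
      rw [hb]
      simp [hn]
  have ha : n₁ + (2 * τ + 1 - τ) * (-n₁ / (τ + 1)) = 0 := by
    field_simp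
    ring
  by_cases h2 : τ + l = 0
  · have hτ : τ = -l := by linear_combination h2
    subst hτ
    by_cases hn : n₂ = 0
    · subst hn
      refine Or.inl ((algIso_typeB_shift one_ne_zero one_ne_zero (-n₁ / (-l + 1)) 0).trans
        (AlgIso.of_eq ?_))
      rw [ha]
      simp
    · refine Or.inr (Or.inr ((algIso_typeB_shift one_ne_zero hn (-n₁ / (-l + 1)) 0).trans
        (AlgIso.of_eq ?_)))
      rw [ha]
      simp [hn]
  · have hb : n₂ + (2 * τ + l - τ) * (-n₂ / (τ + l)) = 0 := by
      field_simp
      ring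
    refine Or.inl ((algIso_typeB_shift one_ne_zero one_ne_zero (-n₁ / (τ + 1))
      (-n₂ / (τ + l))).trans (AlgIso.of_eq ?_))
    simp [ha, hb]

/-- The shift coefficient of `a` is `1/2`, hence `a = -2 n₁`; that of `b` is `0`, so `n₂` can only
be scaled. The ratio of the scales is fixed by normalising `q` to `1`. -/
theorem algIso_typeB_jordan {q : ℂ} (hq : q ≠ 0) (n₁ n₂ : ℂ) :
    AlgIso (CharAlg (typeB (1 / 2) (-1 / 2) q 0 (-1 / 2) (-1 / 2) n₁ n₂))
        (CharAlg (D14 (1 / 2))) ∨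
      AlgIso (CharAlg (typeB (1 / 2) (-1 / 2) q 0 (-1 / 2) (-1 / 2) n₁ n₂)) (CharAlg DS4) := by
  rw [D14_eq_typeB, DS4_eq_typeB]
  by_cases hn : n₂ = 0
  · subst hn
    refine Or.inl ((algIso_typeB_shift hq one_ne_zero (-2 * n₁) 0).trans (AlgIso.of_eq ?_))
    congr 1 <;> field_simp <;> ring
  · refine Or.inr ((algIso_typeB_shift (mul_ne_zero hq hn) hn (-2 * n₁) 0).trans
      (AlgIso.of_eq ?_))
    congr 1 <;> field_simp <;> ring

theorem algIso_typeC_diag (τ n : ℂ) :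
    AlgIso (CharAlg (typeC (1 / 2) τ τ τ n)) (CharAlg (DS5 τ)) ∨
      AlgIso (CharAlg (typeC (1 / 2) τ τ τ n)) (CharAlg DS6) := by
  rw [DS5_eq_typeC, DS6_eq_typeC]
  by_cases h1 : τ + 1 = 0
  · have hτ : τ = -1 := by linear_combination h1
    subst hτ
    by_cases hn : n = 0
    · subst hn
      exact Or.inl (AlgIso.of_eq rfl)
    · obtain ⟨w, hw⟩ := IsAlgClosed.exists_pow_nat_eq n (n := 2) (by norm_num)
      have hw0 : w ≠ 0 := by
        rintro rfl
        simp at hw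
        exact hn hw.symm
      refine Or.inr ((algIso_typeC_shift hw0 0).trans (AlgIso.of_eq ?_))
      simp [hw, hn]
  · refine Or.inl ((algIso_typeC_shift one_ne_zero (-n / (τ + 1))).trans (AlgIso.of_eq ?_))
    congr 1
    field_simp
    ring

theorem HasNormalForm.algIso_of_isNovikov [IsScalarTower ℂ A A] (hl0 : l ≠ 0) (hl1 : l ≠ 1)
    (hl2 : l ≠ 2) (h : HasNormalForm l A) (hA : IsNovikov A) :
    AlgIso A (CharAlg (D1 l 0)) ∨ (∃ t : ℂ, t ≠ 0 ∧ AlgIso A (CharAlg (D11 l t))) ∨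
      AlgIso A (CharAlg (D12 l)) ∨ AlgIso A (CharAlg (D13 l)) ∨
      (l = 1 / 2 ∧ (AlgIso A (CharAlg (D14 (1 / 2))) ∨ AlgIso A (CharAlg (DS1 0)) ∨
        AlgIso A (CharAlg DS4) ∨ (∃ t : ℂ, t ≠ 0 ∧ AlgIso A (CharAlg (DS5 t))) ∨
        AlgIso A (CharAlg DS6))) := by
  rcases h with ⟨μ, a, b, c, d, h1, h2, h3, h4, h5, h6⟩ |
    ⟨p, q, r, s, τ, n₁, n₂, h1, h2, h3, h4, h5⟩ | ⟨t, y, τ, n, h1, h2, h3, h4⟩ |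
    ⟨t, y, τ, n, h1, h2, h3, h4⟩ | ⟨x, d, h1, h2⟩ | ⟨x, d, h1, h2⟩
  · have e := sum_of_isNovikov (hA.of_algIso h6)
    have e1 := e 2 0 2 0
    have e2 := e 1 0 0 0
    simp [Fin.sum_univ_three, typeA] at e1 e2
    subst e1
    have ha : a = 0 := by grind
    have hd : d = 0 := by grind
    have hc : c = 0 := by grind
    subst ha hd hc
    by_cases hb : b = 0
    · subst hb
      exact Or.inl (h6.trans (AlgIso.of_eq (D1_eq_typeA l 0).symm))
    · have hl : l = 1 / 2 := by grind
      subst hl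
      refine Or.inr (Or.inr (Or.inr (Or.inr ⟨rfl, Or.inr (Or.inl (h6.trans
        ((algIso_typeA_scale hb one_ne_zero).trans (AlgIso.of_eq ?_))))⟩)))
      simp [DS1_eq_typeA, hb]
  · have e := sum_of_isNovikov (hA.of_algIso h5)
    have e1 := e 0 2 2 0
    have e2 := e 0 2 2 1
    have e3 := e 1 2 2 0
    have e4 := e 1 2 2 1
    simp [Fin.sum_univ_three, typeB] at e1 e2 e3 e4
    have hr : r = 0 := by
      have : r * (2 - l) = 0 := by linear_combination e2 - h3
      simpa [sub_eq_zero, hl2.symm] using this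
    subst hr
    -- Subtracting left-symmetry from commutation of right multiplications leaves `p = τ` here and
    -- `l (s - τ) = 0` below.
    have hp : p = τ := by grind
    have hs : s = τ := by
      have : l * (s - τ) = 0 := by linear_combination e4 - h4
      simpa [hl0, sub_eq_zero] using this
    subst hp hs
    by_cases hq : q = 0
    · subst hq
      rcases algIso_typeB_diag hl1 s n₁ n₂ with h | h | h
      · by_cases hs : s = 0
        · subst hs
          refine Or.inl (h5.trans (h.trans (AlgIso.of_eq ?_)))
          funext i j k
          fin_cases i <;> fin_cases j <;> fin_cases k <;> simp [D1, D11, e₁, e₂, e₃]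
        · exact Or.inr (Or.inl ⟨s, hs, h5.trans h⟩)
      · exact Or.inr (Or.inr (Or.inl (h5.trans h)))
      · exact Or.inr (Or.inr (Or.inr (Or.inl (h5.trans h))))
    -- For `q ≠ 0`, left-symmetry gives `τ = l - 1` and the Novikov identity gives `τ = -l`.
    · have hl : l = 1 / 2 := by grind
      subst hl
      have hs : s = -1 / 2 := by grind
      subst hs
      refine Or.inr (Or.inr (Or.inr (Or.inr ⟨rfl, ?_⟩)))
      rcases algIso_typeB_jordan hq n₁ n₂ with h | h
      · exact Or.inl (h5.trans h)
      · exact Or.inr (Or.inr (Or.inl (h5.trans h)))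
  · have e := sum_of_isNovikov (hA.of_algIso h4)
    have e1 := e 1 2 1 0
    have e2 := e 0 2 2 0
    simp [Fin.sum_univ_three, typeC] at e1 e2
    have hl : l = 1 / 2 := by grind
    have ht : t = y := by grind
    have hy : y = τ := by grind
    subst hl ht hy
    refine Or.inr (Or.inr (Or.inr (Or.inr ⟨rfl, ?_⟩)))
    rcases algIso_typeC_diag t n with h | h
    · by_cases ht : t = 0
      · subst ht
        refine Or.inr (Or.inl (h4.trans (h.trans (AlgIso.of_eq ?_))))
        funext i j k
        fin_cases i <;> fin_cases j <;> fin_cases k <;> simp [DS1, DS5, e₁, e₂, e₃]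
      · exact Or.inr (Or.inr (Or.inr (Or.inl ⟨t, ht, h4.trans h⟩)))
    · exact Or.inr (Or.inr (Or.inr (Or.inr (h4.trans h))))
  · have e := sum_of_isNovikov (hA.of_algIso h4)
    have e1 := e 0 2 0 1
    simp [Fin.sum_univ_three, typeD] at e1
    grind
  · have e := sum_of_isNovikov (hA.of_algIso h2)
    have e1 := e 1 2 1 2
    simp [Fin.sum_univ_three, typeE] at e1
    grind
  · have e := sum_of_isNovikov (hA.of_algIso h2)
    have e1 := e 0 2 0 2
    simp [Fin.sum_univ_three, typeF] at e1
    grind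

end LSA

namespace LSA

open CharAlg

/-! ### The named algebras have the stated properties -/

theorem isLeftSymmetricOn_D1 (l t : ℂ) : IsLeftSymmetricOn (CharAlg (D1 l t)) l := by
  rw [D1_eq_typeA]
  exact (isTableOn_typeA (by ring) (by ring) (by ring) (by ring) (by ring)).isLeftSymmetricOn

theorem isLeftSymmetricOn_D10 (l : ℂ) : IsLeftSymmetricOn (CharAlg (D10 l)) l := by
  rw [D10_eq_typeA]
  exact (isTableOn_typeA (by ring) (by ring) (by ring) (by ring) (by ring)).isLeftSymmetricOn

theorem isLeftSymmetricOn_DS1 (t : ℂ) : IsLeftSymmetricOn (CharAlg (DS1 t)) (1 / 2) := by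
  rw [DS1_eq_typeA]
  exact (isTableOn_typeA (by ring) (by ring) (by ring) (by ring) (by ring)).isLeftSymmetricOn

theorem isLeftSymmetricOn_DS7 : IsLeftSymmetricOn (CharAlg DS7) (1 / 2) := by
  rw [DS7_eq_typeA]
  exact (isTableOn_typeA (by ring) (by ring) (by ring) (by ring) (by ring)).isLeftSymmetricOn

theorem isLeftSymmetricOn_typeB_diag (l τ n₁ n₂ : ℂ) :
    IsLeftSymmetricOn (CharAlg (typeB l τ 0 0 τ τ n₁ n₂)) l :=
  (isTableOn_typeB (by ring) (by ring) (by ring) (by ring)).isLeftSymmetricOn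

theorem isLeftSymmetricOn_typeB_jordan (n₁ n₂ : ℂ) :
    IsLeftSymmetricOn (CharAlg (typeB (1 / 2) (-1 / 2) 1 0 (-1 / 2) (-1 / 2) n₁ n₂)) (1 / 2) :=
  (isTableOn_typeB (by ring) (by ring) (by ring) (by ring)).isLeftSymmetricOn

theorem isLeftSymmetricOn_typeB_neg_one (n₁ n₂ : ℂ) :
    IsLeftSymmetricOn (CharAlg (typeB (-1) 0 0 0 1 1 n₁ n₂)) (-1) :=
  (isTableOn_typeB (by ring) (by ring) (by ring) (by ring)).isLeftSymmetricOn

theorem isLeftSymmetricOn_typeC_diag (τ n : ℂ) :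
    IsLeftSymmetricOn (CharAlg (typeC (1 / 2) τ τ τ n)) (1 / 2) :=
  (isTableOn_typeC (by ring) (by ring) (by ring)).isLeftSymmetricOn

theorem isAssoc_typeB : IsAssoc (CharAlg (typeB (-1) 0 0 0 1 1 0 0)) := by
  apply isAssoc_of_assocCoord
  intro i j k m
  fin_cases i <;> fin_cases j <;> fin_cases k <;> fin_cases m <;>
    simp [assocCoord, Fin.sum_univ_three, typeB]

theorem isBiSymmetric_typeB (n₁ n₂ : ℂ) :
    IsBiSymmetric (CharAlg (typeB (-1) 0 0 0 1 1 n₁ n₂)) := by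
  apply isBiSymmetric_of_assocCoord
  intro i j k m
  refine eq_swap_of_lt (F := fun j k => assocCoord (typeB (-1) 0 0 0 1 1 n₁ n₂) i j k m)
    ?_ ?_ ?_ j k <;>
  fin_cases i <;> fin_cases m <;>
    simp [assocCoord, Fin.sum_univ_three, typeB]

theorem isNovikov_typeB_diag (l τ n₁ n₂ : ℂ) :
    IsNovikov (CharAlg (typeB l τ 0 0 τ τ n₁ n₂)) := by
  apply isNovikov_of_sum
  intro k m
  refine eq_swap_of_lt ?_ ?_ ?_ <;>
  fin_cases k <;> fin_cases m <;>
    simp [Fin.sum_univ_three, typeB, mul_comm]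

theorem isNovikov_typeB_jordan (n : ℂ) :
    IsNovikov (CharAlg (typeB (1 / 2) (-1 / 2) 1 0 (-1 / 2) (-1 / 2) 0 n)) := by
  apply isNovikov_of_sum
  intro k m
  refine eq_swap_of_lt ?_ ?_ ?_ <;>
  fin_cases k <;> fin_cases m <;>
    simp [Fin.sum_univ_three, typeB] <;> norm_num

theorem isNovikov_typeC_diag (τ n : ℂ) :
    IsNovikov (CharAlg (typeC (1 / 2) τ τ τ n)) := by
  apply isNovikov_of_sum
  intro k m
  refine eq_swap_of_lt ?_ ?_ ?_ <;>
  fin_cases k <;> fin_cases m <;>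
    simp [Fin.sum_univ_three, typeC, mul_comm]

theorem isNovikov_typeA (l b : ℂ) : IsNovikov (CharAlg (typeA l 0 0 b 0 0)) := by
  apply isNovikov_of_sum
  intro k m
  refine eq_swap_of_lt ?_ ?_ ?_ <;>
  fin_cases k <;> fin_cases m <;>
    simp [Fin.sum_univ_three, typeA]

theorem isTransitive_typeA {l b c : ℂ} (hc : c * (1 + l) = 0) (hbc : b * c = 0) :
    IsTransitive (CharAlg (typeA l 0 0 b c 0)) := by
  apply isTransitive_of_cube
  intro x y
  apply (co _).injective
  funext k
  simp only [co_mul, prd_apply, map_zero, Pi.zero_apply]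
  generalize co (typeA l 0 0 b c 0) x = x
  generalize co (typeA l 0 0 b c 0) y = y
  fin_cases k <;> simp [Fin.sum_univ_three, typeA]
  · linear_combination (x 1 * x 0 ^ 2 * y 2 + x 1 ^ 2 * x 0 * y 1 * b) * hc +
      y 0 * x 1 ^ 3 * l * hbc
  -- The second coordinate is a multiple of the third coordinate of `(yx)x`, which already vanishes.
  · left; left
    linear_combination y 1 * x 1 ^ 2 * hbc + y 2 * x 0 * x 1 * hc
  · linear_combination y 2 * x 1 ^ 3 * l * hbc +
      (c * y 1 * x 1 * x 0 ^ 2 + c * y 0 * x 1 ^ 2 * x 0) * hc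

/-- Left multiplication by `e₃` is diagonal with eigenvalues `1, l, 1 + l`, distinct since `l ≠ 0,
1`, so a nonzero ideal contains a basis vector. Any basis vector generates everything: `e₁e₂ = e₃`,
and `e₃` yields `e₁` and `l e₂`. -/
theorem isSimpleAlg_typeA {l : ℂ} (hl0 : l ≠ 0) (hl1 : l ≠ 1) (b : ℂ) :
    IsSimpleAlg (CharAlg (typeA l (1 + l) 0 b 1 0)) := by
  set M := typeA l (1 + l) 0 b 1 0 with hM
  intro I hI
  have h01 : bas M 0 * bas M 1 = bas M 2 := by
    apply (co M).injective
    rw [co_bas_mul_bas, co_bas]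
    funext k
    fin_cases k <;> simp [hM, typeA]
  have h20 : bas M 2 * bas M 0 = bas M 0 := by
    apply (co M).injective
    rw [co_bas_mul_bas, co_bas]
    funext k
    fin_cases k <;> simp [hM, typeA]
  have h21 : bas M 2 * bas M 1 = l • bas M 1 := by
    apply (co M).injective
    rw [co_bas_mul_bas, map_smul, co_bas]
    funext k
    fin_cases k <;> simp [hM, typeA]
  have h22 : bas M 2 * bas M 2 = (1 + l) • bas M 2 := by
    apply (co M).injective
    rw [co_bas_mul_bas, map_smul, co_bas]
    funext k
    fin_cases k <;> simp [hM, typeA]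
  have hdecomp : ∀ x : CharAlg M,
      x = co M x 0 • bas M 0 + co M x 1 • bas M 1 + co M x 2 • bas M 2 := fun x => by
    apply (co M).injective
    funext k
    fin_cases k <;> simp
  have hmul : ∀ x : CharAlg M, bas M 2 * x =
      co M x 0 • bas M 0 + (l * co M x 1) • bas M 1 + ((1 + l) * co M x 2) • bas M 2 := fun x => by
    conv_lhs => rw [hdecomp x]
    simp only [mul_add, mul_smul_comm, h20, h21, h22, smul_smul, mul_comm (co M x 1) l,
      mul_comm (co M x 2) (1 + l)]
  have htop : bas M 2 ∈ I → I = ⊤ := by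
    intro h2
    have h0 : bas M 0 ∈ I := h20 ▸ (hI (bas M 0) _ h2).2
    have h1 : bas M 1 ∈ I := by
      have := I.smul_mem l⁻¹ (h21 ▸ (hI (bas M 1) _ h2).2)
      rwa [smul_smul, inv_mul_cancel₀ hl0, one_smul] at this
    rw [eq_top_iff]
    intro x _
    rw [hdecomp x]
    exact I.add_mem (I.add_mem (I.smul_mem _ h0) (I.smul_mem _ h1)) (I.smul_mem _ h2)
  by_contra! hne
  obtain ⟨hbot, hnt⟩ := hne
  obtain ⟨x, hx, hx0⟩ := I.ne_bot_iff.1 hbot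
  have hn2 : bas M 2 ∉ I := fun h => hnt (htop h)
  have hn0 : bas M 0 ∉ I := fun h => hn2 (h01 ▸ (hI (bas M 1) _ h).2)
  have hn1 : bas M 1 ∉ I := fun h => hn2 (h01 ▸ (hI (bas M 0) _ h).1)
  have hx1 := (hI (bas M 2) _ hx).1
  have hx2 := (hI (bas M 2) _ hx1).1
  have hkill : ∀ (v : CharAlg M) (c : ℂ), c • v ∈ I → v ∉ I → c = 0 := by
    intro v c hcv hv
    by_contra hc
    exact hv ((I.smul_mem_iff hc).1 hcv)
  -- This is `(L - α)(L - β) x` for `L` left multiplication by `e₃`; choosing two of the eigenvalues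
  -- isolates one coordinate.
  have hcoord : ∀ α β : ℂ, ((1 - α) * (1 - β) * co M x 0) • bas M 0 +
      ((l - α) * (l - β) * co M x 1) • bas M 1 +
      ((1 + l - α) * (1 + l - β) * co M x 2) • bas M 2 ∈ I := by
    intro α β
    have : bas M 2 * (bas M 2 * x) - (α + β) • (bas M 2 * x) + (α * β) • x ∈ I :=
      I.add_mem (I.sub_mem hx2 (I.smul_mem _ hx1)) (I.smul_mem _ hx)
    convert this using 1
    apply (co M).injective
    funext k
    rw [hmul, hmul]
    fin_cases k <;> simp <;> ring
  have hl1' : 1 - l ≠ 0 := sub_ne_zero.2 hl1.symm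
  have hc0 : co M x 0 = 0 := by
    have := hcoord l (1 + l)
    simp only [sub_self, mul_zero, zero_mul, zero_smul, add_zero] at this
    simpa [hl0, hl1'] using hkill _ _ this hn0
  have hc1 : co M x 1 = 0 := by
    have := hcoord 1 (1 + l)
    simp only [sub_self, mul_zero, zero_mul, zero_smul, add_zero, zero_add] at this
    simpa [hl0, hl1', sub_ne_zero.2 hl1] using hkill _ _ this hn1
  have hc2 : co M x 2 = 0 := by
    have := hcoord 1 l
    simp only [sub_self, mul_zero, zero_mul, zero_smul, add_zero, zero_add] at this
    simpa [hl0] using hkill _ _ this hn2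
  apply hx0
  rw [hdecomp x, hc0, hc1, hc2]
  simp

end LSA

/-! ### The classification -/

theorem proposition3p14 (l : ℂ) (hl : LSA.Param l)
    (A : Type*) [NonUnitalNonAssocRing A] [Module ℂ A]
    [IsScalarTower ℂ A A] [SMulCommClass ℂ A A] :
    -- associative
    ((LSA.IsLeftSymmetricOn A l ∧ LSA.IsAssoc A) ↔
      (l = -1 ∧ LSA.AlgIso A (LSA.CharAlg (LSA.D4 (-1) 1)))) ∧
    -- transitive
    ((LSA.IsLeftSymmetricOn A l ∧ LSA.IsTransitive A) ↔
      (LSA.AlgIso A (LSA.CharAlg (LSA.D1 l 0)) ∨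
        (l = -1 ∧ LSA.AlgIso A (LSA.CharAlg (LSA.D10 (-1)))) ∨
        (l = 1 / 2 ∧ LSA.AlgIso A (LSA.CharAlg (LSA.DS1 0))))) ∧
    -- Novikov
    ((LSA.IsLeftSymmetricOn A l ∧ LSA.IsNovikov A) ↔
      (LSA.AlgIso A (LSA.CharAlg (LSA.D1 l 0)) ∨
        (∃ t : ℂ, t ≠ 0 ∧ LSA.AlgIso A (LSA.CharAlg (LSA.D11 l t))) ∨
        LSA.AlgIso A (LSA.CharAlg (LSA.D12 l)) ∨
        LSA.AlgIso A (LSA.CharAlg (LSA.D13 l)) ∨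
        (l = 1 / 2 ∧
          (LSA.AlgIso A (LSA.CharAlg (LSA.D14 (1 / 2))) ∨
            LSA.AlgIso A (LSA.CharAlg (LSA.DS1 0)) ∨
            LSA.AlgIso A (LSA.CharAlg LSA.DS4) ∨
            (∃ t : ℂ, t ≠ 0 ∧ LSA.AlgIso A (LSA.CharAlg (LSA.DS5 t))) ∨
            LSA.AlgIso A (LSA.CharAlg LSA.DS6))))) ∧
    -- bi-symmetric
    ((LSA.IsLeftSymmetricOn A l ∧ LSA.IsBiSymmetric A) ↔
      (l = -1 ∧
        (LSA.AlgIso A (LSA.CharAlg (LSA.D4 (-1) 1)) ∨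
          LSA.AlgIso A (LSA.CharAlg (LSA.D5 (-1))) ∨
          LSA.AlgIso A (LSA.CharAlg (LSA.D8 (-1))) ∨
          LSA.AlgIso A (LSA.CharAlg LSA.DT1)))) ∧
    -- simple
    ((LSA.IsLeftSymmetricOn A l ∧ LSA.IsSimpleAlg A) ↔
      (LSA.AlgIso A (LSA.CharAlg (LSA.D10 l)) ∨
        (l = 1 / 2 ∧ LSA.AlgIso A (LSA.CharAlg LSA.DS7)))) := by
  have hl0 := hl.ne_zero
  have hl1 := hl.ne_one
  have hl2 := hl.ne_two
  have hl3 := hl.ne_three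
  refine ⟨⟨fun h => (h.1.hasNormalForm hl0 hl1 hl2).algIso_of_isAssoc hl0 hl1 hl2 h.2, ?_⟩,
    ⟨fun h => (h.1.hasNormalForm hl0 hl1 hl2).algIso_of_isTransitive hl0 hl1 hl2 h.2, ?_⟩,
    ⟨fun h => (h.1.hasNormalForm hl0 hl1 hl2).algIso_of_isNovikov hl0 hl1 hl2 h.2, ?_⟩,
    ⟨fun h => (h.1.hasNormalForm hl0 hl1 hl2).algIso_of_isBiSymmetric hl0 hl1 hl2 hl3 h.2, ?_⟩,
    ⟨fun h => (h.1.hasNormalForm hl0 hl1 hl2).algIso_of_isSimpleAlg hl0 hl1 h.2, ?_⟩⟩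
  · rintro ⟨rfl, h⟩
    rw [LSA.D4_eq_typeB] at h
    exact ⟨(LSA.isLeftSymmetricOn_typeB_neg_one 0 0).of_algIso h.symm,
      LSA.isAssoc_typeB.of_algIso h.symm⟩
  · rintro (h | ⟨rfl, h⟩ | ⟨rfl, h⟩)
    · refine ⟨(LSA.isLeftSymmetricOn_D1 l 0).of_algIso h.symm, ?_⟩
      rw [LSA.D1_eq_typeA] at h
      exact (LSA.isTransitive_typeA (by ring) (by ring)).of_algIso h.symm
    · refine ⟨(LSA.isLeftSymmetricOn_D10 (-1)).of_algIso h.symm, ?_⟩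
      rw [LSA.D10_eq_typeA, add_neg_cancel] at h
      exact (LSA.isTransitive_typeA (by ring) (by ring)).of_algIso h.symm
    · refine ⟨(LSA.isLeftSymmetricOn_DS1 0).of_algIso h.symm, ?_⟩
      rw [LSA.DS1_eq_typeA] at h
      exact (LSA.isTransitive_typeA (by ring) (by ring)).of_algIso h.symm
  · rintro (h | ⟨t, -, h⟩ | h | h | ⟨rfl, h | h | h | ⟨t, -, h⟩ | h⟩)
    · refine ⟨(LSA.isLeftSymmetricOn_D1 l 0).of_algIso h.symm, ?_⟩
      rw [LSA.D1_eq_typeA] at h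
      exact (LSA.isNovikov_typeA l 0).of_algIso h.symm
    · rw [LSA.D11_eq_typeB] at h
      exact ⟨(LSA.isLeftSymmetricOn_typeB_diag _ _ _ _).of_algIso h.symm,
        (LSA.isNovikov_typeB_diag _ _ _ _).of_algIso h.symm⟩
    · rw [LSA.D12_eq_typeB] at h
      exact ⟨(LSA.isLeftSymmetricOn_typeB_diag _ _ _ _).of_algIso h.symm,
        (LSA.isNovikov_typeB_diag _ _ _ _).of_algIso h.symm⟩
    · rw [LSA.D13_eq_typeB] at h
      exact ⟨(LSA.isLeftSymmetricOn_typeB_diag _ _ _ _).of_algIso h.symm,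
        (LSA.isNovikov_typeB_diag _ _ _ _).of_algIso h.symm⟩
    · rw [LSA.D14_eq_typeB] at h
      exact ⟨(LSA.isLeftSymmetricOn_typeB_jordan _ _).of_algIso h.symm,
        (LSA.isNovikov_typeB_jordan _).of_algIso h.symm⟩
    · refine ⟨(LSA.isLeftSymmetricOn_DS1 0).of_algIso h.symm, ?_⟩
      rw [LSA.DS1_eq_typeA] at h
      exact (LSA.isNovikov_typeA _ _).of_algIso h.symm
    · rw [LSA.DS4_eq_typeB] at h
      exact ⟨(LSA.isLeftSymmetricOn_typeB_jordan _ _).of_algIso h.symm,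
        (LSA.isNovikov_typeB_jordan _).of_algIso h.symm⟩
    · rw [LSA.DS5_eq_typeC] at h
      exact ⟨(LSA.isLeftSymmetricOn_typeC_diag _ _).of_algIso h.symm,
        (LSA.isNovikov_typeC_diag _ _).of_algIso h.symm⟩
    · rw [LSA.DS6_eq_typeC] at h
      exact ⟨(LSA.isLeftSymmetricOn_typeC_diag _ _).of_algIso h.symm,
        (LSA.isNovikov_typeC_diag _ _).of_algIso h.symm⟩
  · rintro ⟨rfl, h⟩
    rw [LSA.D4_eq_typeB, LSA.D5_eq_typeB, LSA.D8_eq_typeB, LSA.DT1_eq_typeB] at h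
    rcases h with h | h | h | h <;>
    exact ⟨(LSA.isLeftSymmetricOn_typeB_neg_one _ _).of_algIso h.symm,
      (LSA.isBiSymmetric_typeB _ _).of_algIso h.symm⟩
  · rintro (h | ⟨rfl, h⟩)
    · refine ⟨(LSA.isLeftSymmetricOn_D10 l).of_algIso h.symm, ?_⟩
      rw [LSA.D10_eq_typeA] at h
      exact (LSA.isSimpleAlg_typeA hl0 hl1 0).of_algIso h.symm
    · refine ⟨LSA.isLeftSymmetricOn_DS7.of_algIso h.symm, ?_⟩
      rw [LSA.DS7_eq_typeA] at h
      exact (LSA.isSimpleAlg_typeA hl0 hl1 1).of_algIso h.symm
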